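/- Let $k,\kappa,\nu\in\mathbb C$ with $k\neq 0$, $\kappa\ne 0$ and $\kappa^2=1-k^2$ (so $\kappa$ is a choice of $\sqrt{1-k^2}$). Let $\mathrm{sn}(u)=\mathrm{sn}(u,k)$, $\mathrm{cn}(u)$, $\mathrm{dn}(u)$ be the Jacobi elliptic functions of modulus $k$, i.e. the unique meromorphic functions on $\mathbb C$, analytic at $0$, with $\mathrm{sn}'=\mathrm{cn}\,\mathrm{dn}$, $\mathrm{cn}'=-\mathrm{sn}\,\mathrm{dn}$, $\mathrm{dn}'=-k^2\,\mathrm{sn}\,\mathrm{cn}$, $\mathrm{sn}(0)=0$, $\mathrm{cn}(0)=\mathrm{dn}(0)=1$ (they exist and are unique). Write $s=\mathrm{sn}(2q)$, $c=\mathrm{cn}(2q)$, $d=\mathrm{dn}(2q)$. All formulas below are for those $q$ at which $s$ is neither $0$ nor $\infty$, that is, for all $q$ outside a closed discrete subset of $\mathbb C$. Put $$f_h=\frac1{ks},\quad g_h=-\frac{\nu\,d\,c}{k s^2},\quad f_f=-\frac{kc+d}{2k\kappa s},\quad g_f=\frac{\nu(kd+c)}{2k\kappa s^2},\quad f_e=-\frac{kc-d}{2k\kappa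 s},\quad g_e=\frac{\nu(kd-c)}{2k\kappa s^2}.$$ (1) These functions of $q$ are differentiable and solve the system (with $'=d/dq$) $$f_hf_f'-f_ff_h'=-2f_f,\quad f_hg_f'-f_fg_h'=-2g_f,\quad f_hf_e'-f_ef_h'=2f_e,$$ $$f_hg_e'-f_eg_h'=2g_e,\quad f_ef_f'-f_ff_e'=f_h,\quad f_eg_f'-f_fg_e'=g_h,$$ with the boundary conditions $$k^2(f_e-f_f)^2-(f_e+f_f)^2=1,\qquad k^2(f_e-f_f)(g_e-g_f)-(f_e+f_f)(g_e+g_f)=0,$$ and, with $h=f_hp+g_h$, $e=f_ep+g_e$, $f=f_fp+g_f$, one has $h^2+4ef=\nu^2$ for all $p\in\mathbb C$. (2) In the standard basis $S_1=e+f$, $S_2=i(f-e)$, $S_3=h$ these formulas read $$S_1=\frac1\kappa\Big(-\frac cs\,p+\frac{\nu d}{s^2}\Big),\qquad S_2=\frac1{ik\kappa}\Big(\frac ds\,p-\frac{\nu c}{s^2}\Big),\qquad S_3=\frac1k\Big(\frac ps-\frac{\nu\,d\,c}{s^2}\Big),$$ and $\{S_1,S_2\}=2iS_3$, $\{S_2,S_3\}=2iS_1$,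 $\{S_3,S_1\}=2iS_2$ for the bracket $\{F,G\}=\partial_pF\,\partial_qG-\partial_qF\,\partial_pG$. The top Hamiltonian $H=k^2(e-f)^2-(e+f)^2$ becomes $$H=p^2-\frac{\nu^2}{\mathrm{sn}^2(2q,k)}.$$ (3) Let $\theta_{00}(z)=\sum_{n\in\mathbb Z}e^{\pi i n^2\tau+2\pi i nz}$, $\theta_{01}(z)=\sum_n(-1)^ne^{\pi i n^2\tau+2\pi i nz}$, $\theta_{10}(z)=\sum_ne^{\pi i(n+\frac12)^2\tau+2\pi i(n+\frac12)z}$ and let $\vartheta(z)=\sum_n(-1)^ne^{\pi i(n+\frac12)^2\tau+2\pi i(n+\frac12)z}$ be the odd theta function. There is $\tau\in\mathbb C$ with $\mathrm{Im}\,\tau>0$ such that $$k=\frac{\theta_{10}(0)^2}{\theta_{00}(0)^2},\qquad \kappa=-\frac{\theta_{01}(0)^2}{\theta_{00}(0)^2}.$$ For every such $\tau$, put $\omega=\pi\theta_{00}(0)^2$. In the canonically rescaled coordinates $(\tilde p,\tilde q)$ given by $p=\tilde p/\omega$, $q=\omega\tilde q$, $$S_1=-\frac{\theta_{10}(0)\theta_{10}(2\tilde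 q)}{\vartheta'(0)\vartheta(2\tilde q)}\tilde p+\frac{\theta_{10}^2(0)\theta_{00}(2\tilde q)\theta_{01}(2\tilde q)}{\theta_{00}(0)\theta_{01}(0)\vartheta^2(2\tilde q)}\nu,$$ $$S_2=\frac{\theta_{00}(0)\theta_{00}(2\tilde q)}{i\vartheta'(0)\vartheta(2\tilde q)}\tilde p-\frac{\theta_{00}^2(0)\theta_{10}(2\tilde q)\theta_{01}(2\tilde q)}{i\theta_{10}(0)\theta_{01}(0)\vartheta^2(2\tilde q)}\nu,$$ $$S_3=-\frac{\theta_{01}(0)\theta_{01}(2\tilde q)}{\vartheta'(0)\vartheta(2\tilde q)}\tilde p+\frac{\theta_{01}^2(0)\theta_{00}(2\tilde q)\theta_{10}(2\tilde q)}{\theta_{00}(0)\theta_{10}(0)\vartheta^2(2\tilde q)}\nu .$$ Moreover $\omega,\omega\tau$ are linearly independent over $\mathbb R$, and with $\wp$ the Weierstrass function of the lattice $\mathbb Z\omega+\mathbb Z\omega\tau$, in the coordinates $(p,q)$, one has $2q\notin\mathbb Z\omega+\mathbb Z\omega\tau$ and $$H=p^2-\nu^2\Big(\wp(2q)+\frac{1+k^2}{3}\Big),$$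 i.e. up to an additive constant $H$ is the Hamiltonian $p^2-\nu^2\wp(2q)$ of the elliptic two-body Calogero–Moser system. -/

import Mathlib

noncomputable section

namespace XYZTop

/-! ### Jacobi elliptic functions -/

/-- `(s, c, d)` is the triple of Jacobi elliptic functions `sn(·, k)`, `cn(·, k)`, `dn(·, k)` of
modulus `k`: three meromorphic functions on `ℂ` with `s(0) = 0`, `c(0) = d(0) = 1` and
`s' = c d`, `c' = - s d`, `d' = - k² s c`. The normal form condition only fixes the values at
the poles (they are `0`) and excludes removable singularities. -/
structure IsJacobiTriple (k : ℂ) (s c d : ℂ → ℂ) : Prop where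
  meromorphic_s : MeromorphicNFOn s Set.univ
  meromorphic_c : MeromorphicNFOn c Set.univ
  meromorphic_d : MeromorphicNFOn d Set.univ
  analyticAt_zero_s : AnalyticAt ℂ s 0
  analyticAt_zero_c : AnalyticAt ℂ c 0
  analyticAt_zero_d : AnalyticAt ℂ d 0
  s_zero : s 0 = 0
  c_zero : c 0 = 1
  d_zero : d 0 = 1
  ode : ∀ u, AnalyticAt ℂ s u → AnalyticAt ℂ c u → AnalyticAt ℂ d u →
    HasDerivAt s (c u * d u) u ∧ HasDerivAt c (-(s u * d u)) u ∧
      HasDerivAt d (-(k ^ 2 * s u * c u)) u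

/-- The triple `(sn(·, k), cn(·, k), dn(·, k))`. -/
def jacobiTriple (k : ℂ) : (ℂ → ℂ) × (ℂ → ℂ) × (ℂ → ℂ) :=
  Classical.epsilon fun t => IsJacobiTriple k t.1 t.2.1 t.2.2

/-- `sn(u, k)`. -/
def sn (k u : ℂ) : ℂ := (jacobiTriple k).1 u

/-- `cn(u, k)`. -/
def cn (k u : ℂ) : ℂ := (jacobiTriple k).2.1 u

/-- `dn(u, k)`. -/
def dn (k u : ℂ) : ℂ := (jacobiTriple k).2.2 u

/-! ### Theta functions (series, for `Im τ > 0`) -/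

/-- `θ₀₀(z | τ) = ∑ exp(π i n² τ + 2 π i n z)`. -/
def theta00 (τ z : ℂ) : ℂ :=
  ∑' n : ℤ, Complex.exp (Real.pi * Complex.I * (n : ℂ) ^ 2 * τ
    + 2 * Real.pi * Complex.I * (n : ℂ) * z)

/-- `θ₀₁(z | τ) = ∑ (-1)ⁿ exp(π i n² τ + 2 π i n z)`. -/
def theta01 (τ z : ℂ) : ℂ :=
  ∑' n : ℤ, (-1 : ℂ) ^ n * Complex.exp (Real.pi * Complex.I * (n : ℂ) ^ 2 * τ
    + 2 * Real.pi * Complex.I * (n : ℂ) * z)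

/-- `θ₁₀(z | τ) = ∑ exp(π i (n + 1/2)² τ + 2 π i (n + 1/2) z)`. -/
def theta10 (τ z : ℂ) : ℂ :=
  ∑' n : ℤ, Complex.exp (Real.pi * Complex.I * ((n : ℂ) + 1 / 2) ^ 2 * τ
    + 2 * Real.pi * Complex.I * ((n : ℂ) + 1 / 2) * z)

/-- The odd theta function
`ϑ(z | τ) = ∑ (-1)ⁿ exp(π i (n + 1/2)² τ + 2 π i (n + 1/2) z)`
(`i` times Jacobi's `θ₁`). -/
def varTheta (τ z : ℂ) : ℂ :=
  ∑' n : ℤ, (-1 : ℂ) ^ n * Complex.exp (Real.pi * Complex.I * ((n : ℂ) + 1 / 2) ^ 2 * τ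
    + 2 * Real.pi * Complex.I * ((n : ℂ) + 1 / 2) * z)

/-- `ϑ'(0 | τ)`. -/
def varThetaDerivZero (τ : ℂ) : ℂ := deriv (varTheta τ) 0

/-! ### The bosonisation system -/

/-- At the point `q`, the functions `f_h, g_h, f_e, g_e, f_f, g_f` are differentiable and satisfy
the six differential equations that express `{h, e} = 2e`, `{h, f} = -2f`, `{e, f} = h`
for `h = f_h p + g_h`, `e = f_e p + g_e`, `f = f_f p + g_f`. -/
structure BosonisationSystemAt (fh gh fe ge ff gf : ℂ → ℂ) (q : ℂ) : Prop where
  diff_fh : DifferentiableAt ℂ fh q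
  diff_gh : DifferentiableAt ℂ gh q
  diff_fe : DifferentiableAt ℂ fe q
  diff_ge : DifferentiableAt ℂ ge q
  diff_ff : DifferentiableAt ℂ ff q
  diff_gf : DifferentiableAt ℂ gf q
  eq_ff : fh q * deriv ff q - ff q * deriv fh q = -2 * ff q
  eq_gf : fh q * deriv gf q - ff q * deriv gh q = -2 * gf q
  eq_fe : fh q * deriv fe q - fe q * deriv fh q = 2 * fe q
  eq_ge : fh q * deriv ge q - fe q * deriv gh q = 2 * ge q
  eq_fh : fe q * deriv ff q - ff q * deriv fe q = fh q
  eq_gh : fe q * deriv gf q - ff q * deriv ge q = gh q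

/-- The canonical bracket `{F, G} = ∂F/∂p ∂G/∂q - ∂F/∂q ∂G/∂p` of functions of `(p, q)`. -/
def poisson (F G : ℂ → ℂ → ℂ) (p q : ℂ) : ℂ :=
  deriv (fun x => F x q) p * deriv (fun y => G p y) q
    - deriv (fun y => F p y) q * deriv (fun x => G x q) p

/-- The top Hamiltonian `H = k² (e - f)² - (e + f)²`. -/
def topHamiltonian (k e f : ℂ) : ℂ := k ^ 2 * (e - f) ^ 2 - (e + f) ^ 2

/-! ### The explicit coefficients; `κ` is a square root of `1 - k²` -/

def fh (k q : ℂ) : ℂ := 1 / (sn k (2 * q) * k)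

def gh (k ν q : ℂ) : ℂ := -(ν * dn k (2 * q) * cn k (2 * q)) / (sn k (2 * q) ^ 2 * k)

def ff (k κ q : ℂ) : ℂ :=
  -(1 / 2) * ((k * cn k (2 * q) + dn k (2 * q)) / (sn k (2 * q) * k * κ))

def gf (k κ ν q : ℂ) : ℂ :=
  1 / 2 * (ν * (k * dn k (2 * q) + cn k (2 * q)) / (sn k (2 * q) ^ 2 * k * κ))

def fe (k κ q : ℂ) : ℂ :=
  -(1 / 2) * ((k * cn k (2 * q) - dn k (2 * q)) / (sn k (2 * q) * k * κ))

def ge (k κ ν q : ℂ) : ℂ :=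
  1 / 2 * ((k * ν * dn k (2 * q) - ν * cn k (2 * q)) / (sn k (2 * q) ^ 2 * k * κ))

/-- `h = f_h p + g_h`. -/
def bosH (k ν p q : ℂ) : ℂ := fh k q * p + gh k ν q

/-- `e = f_e p + g_e`. -/
def bosE (k κ ν p q : ℂ) : ℂ := fe k κ q * p + ge k κ ν q

/-- `f = f_f p + g_f`. -/
def bosF (k κ ν p q : ℂ) : ℂ := ff k κ q * p + gf k κ ν q

/-- `S₁ = e + f`. -/
def S1 (k κ ν p q : ℂ) : ℂ := bosE k κ ν p q + bosF k κ ν p q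

/-- `S₂ = i (f - e)`. -/
def S2 (k κ ν p q : ℂ) : ℂ := Complex.I * (bosF k κ ν p q - bosE k κ ν p q)

/-- `S₃ = h`. -/
def S3 (k ν p q : ℂ) : ℂ := bosH k ν p q

end XYZTop

end

noncomputable section

namespace XYZTop

open Complex Filter Topology

/-! ### Theta functions with characteristics in terms of `jacobiTheta₂` -/

/-! The theorem rests on a uniformisation: for a suitable τ, k = θ₁₀²/θ₀₀² and κ = -θ₀₁²/θ₀₀² at z =
0, and sn, cn, dn are theta quotients in u/ω with ω = πθ₀₀(0)². The functions 1/sn, cn/sn, dn/sn of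
2q then satisfy a first-order system with two quadratic relations (`ratioSystemAt`), which turns (1)
and (2) into polynomial identities. The theta formulas in (3) follow by substitution and Jacobi's
derivative formula.

The theta identities descend from one duplication formula, `theta00_mul_theta00`, by half-period
shifts. Its relations between τ and 2τ give the nonvanishing of the theta constants and the
derivative formula `varThetaDerivZero_eq_mul`, by following 2ⁿτ to the cusp, where the limits are
explicit. Differentiated addition formulas give Wronskians, which are the Jacobi differential
equations for the quotients (`isJacobiTriple_theta`). Conversely the equations fix all Taylor
coefficients at 0, and the identity theorem for meromorphic functions gives `IsJacobiTriple.unique`.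

Every admissible (k, κ) occurs (`exists_thetaModulus_thetaComodulus`): the absolute invariant of λ =
k² is a nonconstant modular function, so its image is open; it blows up at the cusp and the
truncated fundamental domain is compact, so its image is closed. Hence it takes every value.
Translations and inversions of τ then reach all λ with the same invariant, and all signs of k and κ.

For the potential, the zeros of ϑ are located by Liouville's theorem, so 1/sn² and ℘ have the same
periods and the same double poles. Their difference is constant, and its value is read off from the
expansion of sn at 0 (`one_div_thetaSn_sq_eq`). -/

lemma theta00_eq (τ z : ℂ) : theta00 τ z = jacobiTheta₂ z τ := by
  unfold theta00 jacobiTheta₂ jacobiTheta₂_term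
  refine tsum_congr fun n => ?_
  congr 1
  ring

lemma exp_int_mul_pi_mul_I (n : ℤ) : cexp (n * (Real.pi * I)) = (-1) ^ n := by
  rw [exp_int_mul, exp_pi_mul_I]

lemma theta01_eq (τ z : ℂ) : theta01 τ z = jacobiTheta₂ (z + 1 / 2) τ := by
  unfold theta01 jacobiTheta₂ jacobiTheta₂_term
  refine tsum_congr fun n => ?_
  rw [← exp_int_mul_pi_mul_I, ← Complex.exp_add]
  congr 1
  ring

lemma theta10_eq (τ z : ℂ) :
    theta10 τ z = cexp (Real.pi * I * (τ / 4 + z)) * jacobiTheta₂ (z + τ / 2) τ := by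
  unfold theta10 jacobiTheta₂ jacobiTheta₂_term
  rw [← tsum_mul_left]
  refine tsum_congr fun n => ?_
  rw [← Complex.exp_add]
  congr 1
  ring

lemma varTheta_eq (τ z : ℂ) :
    varTheta τ z = cexp (Real.pi * I * (τ / 4 + z)) * jacobiTheta₂ (z + 1 / 2 + τ / 2) τ := by
  unfold varTheta jacobiTheta₂ jacobiTheta₂_term
  rw [← tsum_mul_left]
  refine tsum_congr fun n => ?_
  rw [← exp_int_mul_pi_mul_I, ← Complex.exp_add, ← Complex.exp_add]
  congr 1
  ring

lemma theta01_eq_theta00 (τ z : ℂ) : theta01 τ z = theta00 τ (z + 1 / 2) := by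
  rw [theta01_eq, theta00_eq]

lemma theta10_eq_theta00 (τ z : ℂ) :
    theta10 τ z = cexp (Real.pi * I * (τ / 4 + z)) * theta00 τ (z + τ / 2) := by
  rw [theta10_eq, theta00_eq]

lemma varTheta_eq_theta10 (τ z : ℂ) : varTheta τ z = -I * theta10 τ (z + 1 / 2) := by
  rw [theta10_eq, varTheta_eq, show (Real.pi : ℂ) * I * (τ / 4 + (z + 1 / 2)) =
    Real.pi * I * (τ / 4 + z) + Real.pi / 2 * I by ring, Complex.exp_add, exp_pi_div_two_mul_I]
  linear_combination (cexp (Real.pi * I * (τ / 4 + z)) *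
    jacobiTheta₂ (z + 1 / 2 + τ / 2) τ) * I_sq

lemma theta00_add_one (τ z : ℂ) : theta00 τ (z + 1) = theta00 τ z := by
  rw [theta00_eq, theta00_eq, jacobiTheta₂_add_left]

lemma theta00_add_tau (τ z : ℂ) :
    theta00 τ (z + τ) = cexp (-Real.pi * I * (τ + 2 * z)) * theta00 τ z := by
  rw [theta00_eq, theta00_eq, jacobiTheta₂_add_left']

lemma theta00_neg (τ z : ℂ) : theta00 τ (-z) = theta00 τ z := by
  rw [theta00_eq, theta00_eq, jacobiTheta₂_neg_left]

lemma theta01_add_one (τ z : ℂ) : theta01 τ (z + 1) = theta01 τ z := by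
  rw [theta01_eq_theta00, theta01_eq_theta00, ← theta00_add_one τ (z + 1 / 2)]
  congr 1
  ring

lemma exp_pi_mul_I_add_one (a z : ℂ) :
    cexp (Real.pi * I * (a + (z + 1))) = -cexp (Real.pi * I * (a + z)) := by
  rw [show (Real.pi : ℂ) * I * (a + (z + 1)) = Real.pi * I * (a + z) + Real.pi * I by ring,
    Complex.exp_add, exp_pi_mul_I]
  ring

lemma theta10_add_one (τ z : ℂ) : theta10 τ (z + 1) = -theta10 τ z := by
  rw [theta10_eq_theta00, theta10_eq_theta00, exp_pi_mul_I_add_one,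
    show z + 1 + τ / 2 = z + τ / 2 + 1 by ring, theta00_add_one]
  ring

lemma theta10_add_half (τ z : ℂ) : theta10 τ (z + 1 / 2) = I * varTheta τ z := by
  rw [varTheta_eq_theta10]
  linear_combination (theta10 τ (z + 1 / 2)) * I_sq

lemma varTheta_add_one (τ z : ℂ) : varTheta τ (z + 1) = -varTheta τ z := by
  rw [varTheta_eq_theta10, varTheta_eq_theta10, show z + 1 + 1 / 2 = z + 1 / 2 + 1 by ring,
    theta10_add_one]
  ring

lemma theta00_add_half_tau (τ z : ℂ) :
    theta00 τ (z + τ / 2) = cexp (-(Real.pi * I * (τ / 4 + z))) * theta10 τ z := by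
  rw [theta10_eq_theta00, ← mul_assoc, ← Complex.exp_add]
  simp

lemma theta10_add_half_tau (τ z : ℂ) :
    theta10 τ (z + τ / 2) = cexp (-(Real.pi * I * (τ / 4 + z))) * theta00 τ z := by
  rw [theta10_eq_theta00, show z + τ / 2 + τ / 2 = z + τ by ring, theta00_add_tau, ← mul_assoc,
    ← Complex.exp_add]
  congr 2
  ring

lemma theta10_add_tau (τ z : ℂ) :
    theta10 τ (z + τ) = cexp (-Real.pi * I * (τ + 2 * z)) * theta10 τ z := by
  rw [show z + τ = z + τ / 2 + τ / 2 by ring, theta10_add_half_tau, theta00_add_half_tau,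
    ← mul_assoc, ← Complex.exp_add]
  congr 2
  ring

lemma theta01_add_tau (τ z : ℂ) :
    theta01 τ (z + τ) = -cexp (-Real.pi * I * (τ + 2 * z)) * theta01 τ z := by
  rw [theta01_eq_theta00, show z + τ + 1 / 2 = z + 1 / 2 + τ by ring, theta00_add_tau,
    ← theta01_eq_theta00, show -(Real.pi : ℂ) * I * (τ + 2 * (z + 1 / 2)) =
      -Real.pi * I * (τ + 2 * z) - Real.pi * I by ring, Complex.exp_sub, exp_pi_mul_I]
  ring

lemma varTheta_add_tau (τ z : ℂ) :
    varTheta τ (z + τ) = -cexp (-Real.pi * I * (τ + 2 * z)) * varTheta τ z := by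
  rw [varTheta_eq_theta10, varTheta_eq_theta10, show z + τ + 1 / 2 = z + 1 / 2 + τ by ring,
    theta10_add_tau, show -(Real.pi : ℂ) * I * (τ + 2 * (z + 1 / 2)) =
      -Real.pi * I * (τ + 2 * z) - Real.pi * I by ring, Complex.exp_sub, exp_pi_mul_I]
  ring

lemma theta01_neg (τ z : ℂ) : theta01 τ (-z) = theta01 τ z := by
  rw [theta01_eq_theta00, theta01_eq_theta00, ← theta00_neg τ (-z + 1 / 2),
    show z + 1 / 2 = -(-z + 1 / 2) + 1 by ring, theta00_add_one]

lemma theta10_neg (τ z : ℂ) : theta10 τ (-z) = theta10 τ z := by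
  rw [theta10_eq_theta00, theta10_eq_theta00, ← theta00_neg τ (-z + τ / 2),
    show z + τ / 2 = -(-z + τ / 2) + τ by ring, theta00_add_tau, ← mul_assoc, ← Complex.exp_add]
  congr 2
  ring

lemma varTheta_neg (τ z : ℂ) : varTheta τ (-z) = -varTheta τ z := by
  rw [varTheta_eq_theta10, varTheta_eq_theta10, ← theta10_neg τ (-z + 1 / 2),
    show z + 1 / 2 = -(-z + 1 / 2) + 1 by ring, theta10_add_one]
  ring

lemma varTheta_zero (τ : ℂ) : varTheta τ 0 = 0 := by
  have h := varTheta_neg τ 0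
  rw [neg_zero] at h
  exact CharZero.eq_neg_self_iff.mp h

/-! ### Product formulas -/

/-- Pairs (m, n) with m + n even are exactly the (a + b, a - b); those with m + n odd are exactly
the (a + b + 1, a - b). -/
lemma tsum_int_prod_parity {f : ℤ × ℤ → ℂ} (hf : Summable f) :
    ∑' p, f p = (∑' p : ℤ × ℤ, f (p.1 + p.2, p.1 - p.2)) +
      ∑' p : ℤ × ℤ, f (p.1 + p.2 + 1, p.1 - p.2) := by
  let e : (ℤ × ℤ) ⊕ (ℤ × ℤ) ≃ ℤ × ℤ :=
    { toFun := Sum.elim (fun p => (p.1 + p.2, p.1 - p.2)) (fun p => (p.1 + p.2 + 1, p.1 - p.2))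
      invFun := fun p => if (p.1 + p.2) % 2 = 0 then Sum.inl ((p.1 + p.2) / 2, (p.1 - p.2) / 2)
        else Sum.inr ((p.1 + p.2) / 2, (p.1 - p.2) / 2)
      left_inv := by
        rintro (⟨a, b⟩ | ⟨a, b⟩)
        · have h : (a + b + (a - b)) % 2 = 0 := by omega
          simp only [Sum.elim_inl, h, if_true, Sum.inl.injEq, Prod.mk.injEq]
          omega
        · have h : (a + b + 1 + (a - b)) % 2 ≠ 0 := by omega
          simp only [Sum.elim_inr, h, if_false, Sum.inr.injEq, Prod.mk.injEq]
          omega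
      right_inv := by
        rintro ⟨m, n⟩
        by_cases h : (m + n) % 2 = 0
        · simp only [h, if_true, Sum.elim_inl, Prod.mk.injEq]
          omega
        · simp only [h, if_false, Sum.elim_inr, Prod.mk.injEq]
          omega }
  rw [← e.tsum_eq]
  have hs := e.summable_iff.mpr hf
  exact Summable.tsum_sum (hs.comp_injective Sum.inl_injective)
    (hs.comp_injective Sum.inr_injective)

/-- For m = a + b, n = a - b one has m² + n² = 2(a² + b²) and mx + ny = a(x + y) + b(x - y), so the
double series factors at 2τ. In the odd class the same holds with a + 1/2, b + 1/2 in place of a, b,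
which produces θ₁₀. -/
lemma theta00_mul_theta00 {τ : ℂ} (hτ : 0 < τ.im) (x y : ℂ) :
    theta00 τ x * theta00 τ y = theta00 (2 * τ) (x + y) * theta00 (2 * τ) (x - y) +
      theta10 (2 * τ) (x + y) * theta10 (2 * τ) (x - y) := by
  have h2 : 0 < (2 * τ).im := by simpa using hτ
  have hs : ∀ (z : ℂ) {σ : ℂ}, 0 < σ.im → Summable fun n => ‖jacobiTheta₂_term n z σ‖ :=
    fun z σ hσ => ((summable_jacobiTheta₂_term_iff z σ).mpr hσ).norm
  simp only [theta00_eq, theta10_eq]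
  rw [mul_mul_mul_comm]
  simp only [jacobiTheta₂]
  rw [tsum_mul_tsum_of_summable_norm (hs _ hτ) (hs _ hτ),
    tsum_mul_tsum_of_summable_norm (hs _ h2) (hs _ h2),
    tsum_mul_tsum_of_summable_norm (hs _ h2) (hs _ h2), tsum_int_prod_parity, ← tsum_mul_left]
  · congr 1
    · refine tsum_congr fun p => ?_
      simp only [jacobiTheta₂_term, ← Complex.exp_add]
      congr 1
      push_cast
      ring
    · refine tsum_congr fun p => ?_
      simp only [jacobiTheta₂_term, ← Complex.exp_add]
      congr 1
      push_cast
      ring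
  · exact summable_mul_of_summable_norm (f := fun n => jacobiTheta₂_term n x τ)
      (g := fun n => jacobiTheta₂_term n y τ) (hs _ hτ) (hs _ hτ)

lemma theta01_mul_theta01 {τ : ℂ} (hτ : 0 < τ.im) (x y : ℂ) :
    theta01 τ x * theta01 τ y = theta00 (2 * τ) (x + y) * theta00 (2 * τ) (x - y) -
      theta10 (2 * τ) (x + y) * theta10 (2 * τ) (x - y) := by
  rw [theta01_eq_theta00, theta01_eq_theta00, theta00_mul_theta00 hτ,
    show x + 1 / 2 + (y + 1 / 2) = x + y + 1 by ring, theta00_add_one, theta10_add_one,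
    add_sub_add_right_eq_sub]
  ring

lemma theta10_mul_theta10 {τ : ℂ} (hτ : 0 < τ.im) (x y : ℂ) :
    theta10 τ x * theta10 τ y = theta10 (2 * τ) (x + y) * theta00 (2 * τ) (x - y) +
      theta00 (2 * τ) (x + y) * theta10 (2 * τ) (x - y) := by
  rw [theta10_eq_theta00 τ, theta10_eq_theta00 τ, mul_mul_mul_comm, theta00_mul_theta00 hτ,
    show x + τ / 2 + (y + τ / 2) = x + y + 2 * τ / 2 by ring, theta00_add_half_tau,
    theta10_add_half_tau, add_sub_add_right_eq_sub, ← Complex.exp_add]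
  have h : cexp (Real.pi * I * (τ / 4 + x) + Real.pi * I * (τ / 4 + y)) *
      cexp (-(Real.pi * I * (2 * τ / 4 + (x + y)))) = 1 := by
    rw [← Complex.exp_add, ← Complex.exp_zero]
    congr 1
    ring
  linear_combination (theta10 (2 * τ) (x + y) * theta00 (2 * τ) (x - y) +
    theta00 (2 * τ) (x + y) * theta10 (2 * τ) (x - y)) * h

lemma varTheta_mul_varTheta {τ : ℂ} (hτ : 0 < τ.im) (x y : ℂ) :
    varTheta τ x * varTheta τ y = theta10 (2 * τ) (x + y) * theta00 (2 * τ) (x - y) -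
      theta00 (2 * τ) (x + y) * theta10 (2 * τ) (x - y) := by
  have h := theta10_mul_theta10 hτ (x + 1 / 2) (y + 1 / 2)
  rw [theta10_add_half, theta10_add_half, show x + 1 / 2 + (y + 1 / 2) = x + y + 1 by ring,
    theta00_add_one, theta10_add_one, add_sub_add_right_eq_sub] at h
  linear_combination -h + varTheta τ x * varTheta τ y * I_sq

lemma varTheta_mul_theta10 {τ : ℂ} (hτ : 0 < τ.im) (x y : ℂ) :
    varTheta τ x * theta10 τ y = varTheta (2 * τ) (x + y) * theta01 (2 * τ) (x - y) +
      theta01 (2 * τ) (x + y) * varTheta (2 * τ) (x - y) := by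
  rw [varTheta_eq_theta10 τ, mul_assoc, theta10_mul_theta10 hτ,
    show x + 1 / 2 + y = x + y + 1 / 2 by ring, show x + 1 / 2 - y = x - y + 1 / 2 by ring,
    theta10_add_half, theta10_add_half, ← theta01_eq_theta00, ← theta01_eq_theta00]
  linear_combination (-(varTheta (2 * τ) (x + y) * theta01 (2 * τ) (x - y) +
      theta01 (2 * τ) (x + y) * varTheta (2 * τ) (x - y))) * I_sq

lemma theta00_mul_theta01 {τ : ℂ} (hτ : 0 < τ.im) :
    theta00 τ 0 * theta01 τ 0 = theta01 (2 * τ) 0 ^ 2 := by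
  rw [theta01_eq_theta00 τ, theta00_mul_theta00 hτ, zero_add, zero_sub, theta00_neg, theta10_neg,
    ← theta01_eq_theta00]
  have h := theta10_add_half (2 * τ) 0
  rw [zero_add, varTheta_zero, mul_zero] at h
  simp only [zero_add, h]
  ring

/-- The theta series `∑ exp(π i (n + 1/4)² τ + 2 π i (n + 1/4) z)`. -/
def thetaQuarter (τ z : ℂ) : ℂ :=
  cexp (Real.pi * I * (τ / 16 + z / 2)) * theta00 τ (z + τ / 4)

lemma thetaQuarter_add_one (τ z : ℂ) : thetaQuarter τ (z + 1) = I * thetaQuarter τ z := by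
  unfold thetaQuarter
  rw [show z + 1 + τ / 4 = z + τ / 4 + 1 by ring, theta00_add_one,
    show (Real.pi : ℂ) * I * (τ / 16 + (z + 1) / 2) =
      Real.pi * I * (τ / 16 + z / 2) + Real.pi / 2 * I by ring, Complex.exp_add,
    exp_pi_div_two_mul_I]
  ring

lemma thetaQuarter_sub_one (τ z : ℂ) : thetaQuarter τ (z - 1) = -I * thetaQuarter τ z := by
  have h := thetaQuarter_add_one τ (z - 1)
  rw [sub_add_cancel] at h
  rw [h]
  linear_combination thetaQuarter τ (z - 1) * I_sq

lemma theta00_add_quarter_tau (τ z : ℂ) :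
    theta00 τ (z + τ / 4) = cexp (-(Real.pi * I * (τ / 16 + z / 2))) * thetaQuarter τ z := by
  rw [thetaQuarter, ← mul_assoc, ← Complex.exp_add, neg_add_cancel, Complex.exp_zero, one_mul]

lemma theta10_add_quarter_tau (τ z : ℂ) :
    theta10 τ (z + τ / 4) = cexp (-(Real.pi * I * (τ / 16 + z / 2))) * thetaQuarter τ (-z) := by
  rw [thetaQuarter, theta10_eq_theta00, ← theta00_neg τ (-z + τ / 4),
    show z + τ / 4 + τ / 2 = -(-z + τ / 4) + τ by ring, theta00_add_tau, ← mul_assoc,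
    ← Complex.exp_add, ← mul_assoc, ← Complex.exp_add]
  congr 2
  ring

/-- Shifting x alone by τ/2 moves both x + y and x - y by a quarter of the new parameter 2τ; hence
the series with characteristic 1/4. -/
lemma theta10_mul_theta00 {τ : ℂ} (hτ : 0 < τ.im) (x y : ℂ) :
    theta10 τ x * theta00 τ y = thetaQuarter (2 * τ) (x + y) * thetaQuarter (2 * τ) (x - y) +
      thetaQuarter (2 * τ) (-(x + y)) * thetaQuarter (2 * τ) (-(x - y)) := by
  rw [theta10_eq_theta00 τ, mul_assoc, theta00_mul_theta00 hτ,
    show x + τ / 2 + y = x + y + 2 * τ / 4 by ring, show x + τ / 2 - y = x - y + 2 * τ / 4 by ring,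
    theta00_add_quarter_tau, theta00_add_quarter_tau, theta10_add_quarter_tau,
    theta10_add_quarter_tau]
  have h : cexp (Real.pi * I * (τ / 4 + x)) * (cexp (-(Real.pi * I * (2 * τ / 16 + (x + y) / 2))) *
      cexp (-(Real.pi * I * (2 * τ / 16 + (x - y) / 2)))) = 1 := by
    rw [← Complex.exp_add, ← Complex.exp_add, ← Complex.exp_zero]
    congr 1
    ring
  linear_combination (thetaQuarter (2 * τ) (x + y) * thetaQuarter (2 * τ) (x - y) +
      thetaQuarter (2 * τ) (-(x + y)) * thetaQuarter (2 * τ) (-(x - y))) * h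

lemma varTheta_mul_theta01 {τ : ℂ} (hτ : 0 < τ.im) (x y : ℂ) :
    varTheta τ x * theta01 τ y = thetaQuarter (2 * τ) (x + y) * thetaQuarter (2 * τ) (x - y) -
      thetaQuarter (2 * τ) (-(x + y)) * thetaQuarter (2 * τ) (-(x - y)) := by
  rw [varTheta_eq_theta10 τ, theta01_eq_theta00 τ, mul_assoc, theta10_mul_theta00 hτ,
    add_sub_add_right_eq_sub, show x + 1 / 2 + (y + 1 / 2) = x + y + 1 by ring,
    thetaQuarter_add_one, neg_add', thetaQuarter_sub_one]
  linear_combination (-(thetaQuarter (2 * τ) (x + y) * thetaQuarter (2 * τ) (x - y) -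
      thetaQuarter (2 * τ) (-(x + y)) * thetaQuarter (2 * τ) (-(x - y)))) * I_sq

/-! ### Quadratic identities -/

/-- With A = θ₀₀(0), B = θ₁₀(0) at 2τ, the squares of the constants at τ are A² + B², A² - B² and
2AB. The quadratic identities below rest on the same parametrisation. -/
lemma theta00_pow_four {τ : ℂ} (hτ : 0 < τ.im) :
    theta00 τ 0 ^ 4 = theta01 τ 0 ^ 4 + theta10 τ 0 ^ 4 := by
  have h0 := theta00_mul_theta00 hτ 0 0
  have h1 := theta01_mul_theta01 hτ 0 0
  have h2 := theta10_mul_theta10 hτ 0 0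
  rw [add_zero, sub_zero] at h0 h1 h2
  rw [show ∀ x : ℂ, x ^ 4 = (x * x) ^ 2 by intro x; ring,
    show ∀ x : ℂ, x ^ 4 = (x * x) ^ 2 by intro x; ring,
    show ∀ x : ℂ, x ^ 4 = (x * x) ^ 2 by intro x; ring, h0, h1, h2]
  ring

/-- `sn² + cn² = 1` in terms of theta functions. -/
lemma theta01_sq_mul_theta10_sq {τ : ℂ} (hτ : 0 < τ.im) (z : ℂ) :
    theta01 τ z ^ 2 * theta10 τ 0 ^ 2 =
      theta10 τ z ^ 2 * theta01 τ 0 ^ 2 - varTheta τ z ^ 2 * theta00 τ 0 ^ 2 := by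
  have a0 := theta00_mul_theta00 hτ 0 0
  have a1 := theta01_mul_theta01 hτ 0 0
  have a2 := theta10_mul_theta10 hτ 0 0
  have h1 := theta01_mul_theta01 hτ z z
  have h2 := theta10_mul_theta10 hτ z z
  have h3 := varTheta_mul_varTheta hτ z z
  rw [add_zero, sub_zero] at a0 a1 a2
  rw [sub_self] at h1 h2 h3
  simp only [sq, a0, a1, a2, h1, h2, h3]
  ring

/-- `dn² + k² sn² = 1` in terms of theta functions. -/
lemma theta01_sq_mul_theta00_sq {τ : ℂ} (hτ : 0 < τ.im) (z : ℂ) :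
    theta01 τ z ^ 2 * theta00 τ 0 ^ 2 =
      theta00 τ z ^ 2 * theta01 τ 0 ^ 2 - varTheta τ z ^ 2 * theta10 τ 0 ^ 2 := by
  have a0 := theta00_mul_theta00 hτ 0 0
  have a1 := theta01_mul_theta01 hτ 0 0
  have a2 := theta10_mul_theta10 hτ 0 0
  have h1 := theta01_mul_theta01 hτ z z
  have h2 := theta00_mul_theta00 hτ z z
  have h3 := varTheta_mul_varTheta hτ z z
  rw [add_zero, sub_zero] at a0 a1 a2
  rw [sub_self] at h1 h2 h3
  simp only [sq, a0, a1, a2, h1, h2, h3]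
  ring

/-- In terms of `thetaQuarter` at 2τ both sides are the same polynomial in its values at ±2x, ±2y
and 0. To first order in y this is the Wronskian of ϑ and θ₀₁. -/
lemma varTheta_add_mul_theta01_sub {τ : ℂ} (hτ : 0 < τ.im) (x y : ℂ) :
    varTheta τ (x + y) * theta01 τ (x - y) * (theta00 τ 0 * theta10 τ 0) =
      varTheta τ x * theta01 τ x * (theta00 τ y * theta10 τ y) +
        varTheta τ y * theta01 τ y * (theta00 τ x * theta10 τ x) := by
  have a := theta10_mul_theta00 hτ 0 0
  have b := varTheta_mul_theta01 hτ (x + y) (x - y)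
  have c := varTheta_mul_theta01 hτ x x
  have d := varTheta_mul_theta01 hτ y y
  have e := theta10_mul_theta00 hτ x x
  have f := theta10_mul_theta00 hτ y y
  rw [sub_self, neg_zero] at c d e f
  rw [sub_zero, add_zero, neg_zero] at a
  rw [mul_comm (theta00 τ 0), mul_comm (theta00 τ y), mul_comm (theta00 τ x), a, b, c, d, e, f,
    show x + y + (x - y) = x + x by ring, show x + y - (x - y) = y + y by ring]
  ring

lemma theta01_add_mul_theta01_sub {τ : ℂ} (hτ : 0 < τ.im) (x y : ℂ) :
    theta01 τ (x + y) * theta01 τ (x - y) * theta01 τ 0 ^ 2 =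
      theta01 τ x ^ 2 * theta01 τ y ^ 2 - varTheta τ x ^ 2 * varTheta τ y ^ 2 := by
  have a1 := theta01_mul_theta01 hτ 0 0
  have h1 := theta01_mul_theta01 hτ x x
  have h2 := theta01_mul_theta01 hτ y y
  have h3 := varTheta_mul_varTheta hτ x x
  have h4 := varTheta_mul_varTheta hτ y y
  rw [add_zero, sub_zero] at a1
  rw [sub_self] at h1 h2 h3 h4
  rw [theta01_mul_theta01 hτ, show x + y + (x - y) = x + x by ring,
    show x + y - (x - y) = y + y by ring]
  simp only [sq, a1, h1, h2, h3, h4]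
  ring

/-! ### Regularity and behaviour at the cusp -/

lemma differentiable_theta00 {τ : ℂ} (hτ : 0 < τ.im) : Differentiable ℂ (theta00 τ) := by
  rw [show theta00 τ = (jacobiTheta₂ · τ) from funext (theta00_eq τ)]
  exact fun z => differentiableAt_jacobiTheta₂_fst z hτ

lemma differentiable_theta01 {τ : ℂ} (hτ : 0 < τ.im) : Differentiable ℂ (theta01 τ) := by
  rw [show theta01 τ = fun z => theta00 τ (z + 1 / 2) from funext (theta01_eq_theta00 τ)]
  exact (differentiable_theta00 hτ).comp (by fun_prop)

lemma differentiable_theta10 {τ : ℂ} (hτ : 0 < τ.im) : Differentiable ℂ (theta10 τ) := by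
  rw [show theta10 τ = _ from funext (theta10_eq_theta00 τ)]
  exact .mul (by fun_prop) ((differentiable_theta00 hτ).comp (by fun_prop))

lemma differentiable_varTheta {τ : ℂ} (hτ : 0 < τ.im) : Differentiable ℂ (varTheta τ) := by
  rw [show varTheta τ = _ from funext (varTheta_eq_theta10 τ)]
  exact .const_mul ((differentiable_theta10 hτ).comp (by fun_prop)) _

/-- Dominated convergence at the cusp, uniformly in Re τ: for Im τ ≥ 1 the terms are bounded by
their size at Im τ = 1, and only those with exponent 0 survive. -/
lemma tendsto_tsum_exp {c : ℤ → ℂ} {m : ℤ → ℤ} (hm : ∀ n, 0 ≤ m n)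
    (hs : Summable fun n => ‖c n‖ * Real.exp (-Real.pi * m n)) :
    Tendsto (fun τ : ℂ => ∑' n, c n * cexp (Real.pi * I * m n * τ)) (comap im atTop)
      (𝓝 (∑' n, if m n = 0 then c n else 0)) := by
  have hnorm : ∀ (n : ℤ) (τ : ℂ),
      ‖cexp (Real.pi * I * m n * τ)‖ = Real.exp (-Real.pi * m n * τ.im) := by
    intro n τ
    rw [Complex.norm_exp]
    congr 1
    simp
  refine tendsto_tsum_of_dominated_convergence hs (fun n => ?_) ?_
  · split_ifs with h
    · simpa [h] using tendsto_const_nhds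
    · rw [← mul_zero (c n)]
      refine Tendsto.const_mul _ (tendsto_zero_iff_norm_tendsto_zero.mpr ?_)
      simp only [hnorm]
      have hpos : 0 < (m n : ℝ) := by exact_mod_cast lt_of_le_of_ne (hm n) (Ne.symm h)
      refine Real.tendsto_exp_atBot.comp ?_
      exact (tendsto_const_nhds (x := -Real.pi * (m n : ℝ))).neg_mul_atTop
        (by nlinarith [Real.pi_pos]) tendsto_comap
  · filter_upwards [tendsto_comap.eventually (eventually_ge_atTop (1 : ℝ))] with τ hτ n
    rw [norm_mul, hnorm]
    have h0 : 0 ≤ (m n : ℝ) := by exact_mod_cast hm n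
    refine mul_le_mul_of_nonneg_left (Real.exp_le_exp.mpr ?_) (norm_nonneg _)
    nlinarith [mul_nonneg Real.pi_pos.le h0]

lemma summable_theta_bound (k : ℕ) :
    Summable fun n : ℤ => |(n : ℝ)| ^ k * Real.exp (-Real.pi * ((n ^ 2 + n : ℤ) : ℝ)) := by
  refine (summable_pow_mul_jacobiTheta₂_term_bound (1 / 2) one_pos k).of_nonneg_of_le
    (fun n => by positivity) fun n => ?_
  push_cast
  refine mul_le_mul_of_nonneg_left (Real.exp_le_exp.mpr ?_) (by positivity)
  nlinarith [Real.pi_pos, mul_nonneg Real.pi_pos.le (neg_le_iff_add_nonneg.mp (neg_abs_le (n : ℝ)))]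

lemma tendsto_theta00 : Tendsto (fun τ => theta00 τ 0) (comap im atTop) (𝓝 1) := by
  have hs : Summable fun n : ℤ => ‖(1 : ℂ)‖ * Real.exp (-Real.pi * ((n ^ 2 : ℤ) : ℝ)) := by
    simpa using summable_pow_mul_jacobiTheta₂_term_bound 0 one_pos 0
  convert tendsto_tsum_exp (c := fun _ => 1) (fun n => sq_nonneg n) hs using 2 with τ
  · refine tsum_congr fun n => ?_
    rw [one_mul]
    congr 1
    push_cast
    ring
  · rw [tsum_eq_single 0 fun n hn => by simp [hn]]
    simp

lemma tendsto_theta01 : Tendsto (fun τ => theta01 τ 0) (comap im atTop) (𝓝 1) := by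
  have hs : Summable fun n : ℤ => ‖(-1 : ℂ) ^ n‖ * Real.exp (-Real.pi * ((n ^ 2 : ℤ) : ℝ)) := by
    simpa using summable_pow_mul_jacobiTheta₂_term_bound 0 one_pos 0
  convert tendsto_tsum_exp (c := fun n => (-1) ^ n) (fun n => sq_nonneg n) hs using 2 with τ
  · refine tsum_congr fun n => ?_
    congr 2
    push_cast
    ring
  · rw [tsum_eq_single 0 fun n hn => by simp [hn]]
    simp

lemma int_sq_add_self_nonneg (n : ℤ) : 0 ≤ n ^ 2 + n := by
  rcases le_or_gt 0 n with h | h <;> nlinarith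

lemma tsum_ite_sq_add_self (c : ℤ → ℂ) :
    (∑' n : ℤ, if n ^ 2 + n = 0 then c n else 0) = c 0 + c (-1) := by
  rw [tsum_eq_sum (s := {0, -1}) fun n hn => ?_]
  · simp
  · rw [if_neg]
    intro h
    have : n * (n + 1) = 0 := by linarith
    simp only [Finset.mem_insert, Finset.mem_singleton] at hn
    rcases mul_eq_zero.mp this with h | h <;> omega

/-- Removing the leading exponential leaves the exponents (n + 1/2)² - 1/4 = n² + n, which vanish
only for n = 0 and n = -1. -/
lemma tendsto_theta10 :
    Tendsto (fun τ => cexp (-(Real.pi * I * τ / 4)) * theta10 τ 0) (comap im atTop) (𝓝 2) := by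
  have hs : Summable fun n : ℤ => ‖(1 : ℂ)‖ * Real.exp (-Real.pi * ((n ^ 2 + n : ℤ) : ℝ)) := by
    simpa using summable_theta_bound 0
  convert tendsto_tsum_exp (c := fun _ => 1) int_sq_add_self_nonneg hs using 2 with τ
  · rw [theta10, ← tsum_mul_left]
    refine tsum_congr fun n => ?_
    rw [one_mul, ← Complex.exp_add]
    congr 1
    push_cast
    ring
  · rw [tsum_ite_sq_add_self]
    norm_num

lemma varThetaDerivZero_eq {τ : ℂ} (hτ : 0 < τ.im) :
    varThetaDerivZero τ = cexp (Real.pi * I * τ / 4) * jacobiTheta₂' (1 / 2 + τ / 2) τ := by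
  have h0 := varTheta_zero τ
  have h1 : HasDerivAt (fun z => cexp (Real.pi * I * (τ / 4 + z)))
      (cexp (Real.pi * I * (τ / 4 + 0)) * (Real.pi * I * 1)) 0 :=
    (((hasDerivAt_id (0 : ℂ)).const_add (τ / 4)).const_mul (Real.pi * I)).cexp
  have h2 : HasDerivAt (fun z => jacobiTheta₂ (z + 1 / 2 + τ / 2) τ)
      (jacobiTheta₂' (0 + 1 / 2 + τ / 2) τ) 0 :=
    HasDerivAt.comp_add_const (f := fun z => jacobiTheta₂ (z + τ / 2) τ) 0 (1 / 2)
      (HasDerivAt.comp_add_const (f := fun z => jacobiTheta₂ z τ) (0 + 1 / 2) (τ / 2)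
        (hasDerivAt_jacobiTheta₂_fst (0 + 1 / 2 + τ / 2) hτ))
  rw [varTheta_eq] at h0
  have h3 := (mul_eq_zero.mp h0).resolve_left (Complex.exp_ne_zero _)
  rw [varThetaDerivZero, show varTheta τ = _ from funext (varTheta_eq τ), (h1.fun_mul h2).deriv, h3,
    add_zero, zero_add, mul_zero, zero_add, mul_div_assoc]

lemma tendsto_varThetaDerivZero :
    Tendsto (fun τ => cexp (-(Real.pi * I * τ / 4)) * varThetaDerivZero τ) (comap im atTop)
      (𝓝 (2 * Real.pi * I)) := by
  have hs : Summable fun n : ℤ => ‖2 * (Real.pi : ℂ) * I * n * (-1) ^ n‖ *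
      Real.exp (-Real.pi * ((n ^ 2 + n : ℤ) : ℝ)) := by
    refine ((summable_theta_bound 1).mul_left (2 * Real.pi)).congr fun n => ?_
    simp only [norm_mul, norm_zpow, norm_neg, norm_one, one_zpow, Complex.norm_I,
      Complex.norm_real, Real.norm_eq_abs, abs_of_pos Real.pi_pos, Complex.norm_intCast,
      Complex.norm_ofNat]
    ring
  -- The coefficient has n rather than n + 1/2 because differentiating the exponential prefactor
  -- only contributes a multiple of ϑ(0) = 0. Thus n = 0 gives 0 and n = -1 gives 2πi.
  have h := tendsto_tsum_exp (c := fun n => 2 * Real.pi * I * n * (-1) ^ n)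
    int_sq_add_self_nonneg hs
  rw [tsum_ite_sq_add_self] at h
  have h' : 2 * (Real.pi : ℂ) * I * ((0 : ℤ) : ℂ) * (-1) ^ (0 : ℤ) +
      2 * Real.pi * I * ((-1 : ℤ) : ℂ) * (-1) ^ (-1 : ℤ) = 2 * Real.pi * I := by
    norm_num
  rw [h'] at h
  refine h.congr' ?_
  filter_upwards [tendsto_comap.eventually (eventually_gt_atTop (0 : ℝ))] with τ hτ
  rw [varThetaDerivZero_eq hτ, ← mul_assoc, ← Complex.exp_add, neg_add_cancel, Complex.exp_zero,
    one_mul, jacobiTheta₂']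
  refine tsum_congr fun n => ?_
  rw [jacobiTheta₂'_term, jacobiTheta₂_term, ← exp_int_mul_pi_mul_I, mul_assoc, ← Complex.exp_add]
  congr 2
  push_cast
  ring

/-! ### Nonvanishing of the theta constants and the derivative formula -/

lemma im_two_pow_mul {τ : ℂ} (n : ℕ) : ((2 : ℂ) ^ n * τ).im = 2 ^ n * τ.im := by
  rw [show (2 : ℂ) ^ n = ((2 ^ n : ℝ) : ℂ) by push_cast; rfl, Complex.im_ofReal_mul]

lemma im_two_mul_pos {τ : ℂ} (hτ : 0 < τ.im) : 0 < (2 * τ).im := by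
  simpa using hτ

lemma tendsto_two_pow_mul {τ : ℂ} (hτ : 0 < τ.im) :
    Tendsto (fun n : ℕ => (2 : ℂ) ^ n * τ) atTop (comap im atTop) := by
  rw [tendsto_comap_iff]
  simp only [Function.comp_def, im_two_pow_mul]
  exact (tendsto_pow_atTop_atTop_of_one_lt one_lt_two).atTop_mul_const hτ

/-- The doubling principle: what is stable under τ ↦ 2τ is carried along 2ⁿτ to the cusp and can be
tested against the limits there. -/
lemma apply_two_pow_mul {p : ℂ → Prop} (h : ∀ τ : ℂ, 0 < τ.im → p τ → p (2 * τ)) {τ : ℂ}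
    (hτ : 0 < τ.im) (h0 : p τ) (n : ℕ) : p (2 ^ n * τ) := by
  induction n with
  | zero => simpa using h0
  | succ n ih =>
    rw [pow_succ', mul_assoc]
    refine h _ ?_ ih
    rw [im_two_pow_mul]
    positivity

/-- Since θ₀₀θ₀₁ at τ is θ₀₁² at 2τ, a zero would propagate to every 2ⁿτ, against the limit 1. -/
lemma theta01_zero_ne_zero {τ : ℂ} (hτ : 0 < τ.im) : theta01 τ 0 ≠ 0 := by
  intro h0
  have h : ∀ n : ℕ, theta01 (2 ^ n * τ) 0 = 0 := by
    refine apply_two_pow_mul (p := fun τ => theta01 τ 0 = 0) (fun σ hσ h => ?_) hτ h0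
    have := theta00_mul_theta01 hσ
    rw [h, mul_zero] at this
    exact pow_eq_zero_iff two_ne_zero |>.mp this.symm
  have := tendsto_theta01.comp (tendsto_two_pow_mul hτ)
  simp only [Function.comp_def, h] at this
  exact zero_ne_one (tendsto_nhds_unique tendsto_const_nhds this)

lemma theta00_zero_ne_zero {τ : ℂ} (hτ : 0 < τ.im) : theta00 τ 0 ≠ 0 := by
  intro h
  have := theta00_mul_theta01 hτ
  rw [h, zero_mul] at this
  exact theta01_zero_ne_zero (im_two_mul_pos hτ) (pow_eq_zero_iff two_ne_zero |>.mp this.symm)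

/-- Same argument with θ₁₀² at τ equal to 2θ₀₀θ₁₀ at 2τ; the rescaled limit is 2. -/
lemma theta10_zero_ne_zero {τ : ℂ} (hτ : 0 < τ.im) : theta10 τ 0 ≠ 0 := by
  intro h0
  have h : ∀ n : ℕ, theta10 (2 ^ n * τ) 0 = 0 := by
    refine apply_two_pow_mul (p := fun τ => theta10 τ 0 = 0) (fun σ hσ h => ?_) hτ h0
    have := theta10_mul_theta10 hσ 0 0
    rw [h, mul_zero, add_zero, sub_zero, mul_comm (theta00 _ _), ← two_mul] at this
    exact (mul_eq_zero.mp ((mul_eq_zero.mp this.symm).resolve_left two_ne_zero)).resolve_right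
      (theta00_zero_ne_zero (im_two_mul_pos hσ))
  have := tendsto_theta10.comp (tendsto_two_pow_mul hτ)
  simp only [Function.comp_def, h, mul_zero] at this
  exact two_ne_zero (tendsto_nhds_unique tendsto_const_nhds this).symm

lemma hasDerivAt_varTheta_zero {τ : ℂ} (hτ : 0 < τ.im) :
    HasDerivAt (varTheta τ) (varThetaDerivZero τ) 0 :=
  (differentiable_varTheta hτ 0).hasDerivAt

/-- The derivative at x = 0 of ϑ(x|τ)θ₁₀(x|τ) = ϑ(2x|2τ)θ₀₁(0|2τ). -/
lemma varThetaDerivZero_mul_theta10 {τ : ℂ} (hτ : 0 < τ.im) :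
    varThetaDerivZero τ * theta10 τ 0 = 2 * varThetaDerivZero (2 * τ) * theta01 (2 * τ) 0 := by
  have h : (fun x => varTheta τ x * theta10 τ x) =
      fun x => varTheta (2 * τ) (2 * x) * theta01 (2 * τ) 0 := by
    funext x
    rw [varTheta_mul_theta10 hτ, sub_self, varTheta_zero, ← two_mul]
    ring
  have h1 := (hasDerivAt_varTheta_zero hτ).mul (differentiable_theta10 hτ 0).hasDerivAt
  have h2 := hasDerivAt_varTheta_zero (im_two_mul_pos hτ)
  rw [← mul_zero (2 : ℂ)] at h2
  have h3 := (h2.comp (0 : ℂ) ((hasDerivAt_id (0 : ℂ)).const_mul 2)).mul_const (theta01 (2 * τ) 0)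
  have h4 := (h1.congr_deriv rfl).unique (h3.congr_of_eventuallyEq (.of_eq h))
  rw [varTheta_zero] at h4
  linear_combination h4

/-- Jacobi's derivative formula. -/
theorem varThetaDerivZero_eq_mul {τ : ℂ} (hτ : 0 < τ.im) :
    varThetaDerivZero τ = I * Real.pi * (theta00 τ 0 * theta01 τ 0 * theta10 τ 0) := by
  let D : ℂ → ℂ := fun τ => varThetaDerivZero τ / (theta00 τ 0 * theta01 τ 0 * theta10 τ 0)
  -- The quotient of the two sides is invariant under doubling, by the duplication formulas, hence
  -- equal to its limit at the cusp.
  have hD : ∀ n : ℕ, D (2 ^ n * τ) = D τ := by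
    refine apply_two_pow_mul (p := fun σ => D σ = D τ) (fun σ hσ h => ?_) hτ rfl
    have hσ2 := im_two_mul_pos hσ
    rw [← h]
    have e1 := varThetaDerivZero_mul_theta10 hσ
    have e2 := theta00_mul_theta01 hσ
    have e3 := theta10_mul_theta10 hσ 0 0
    rw [add_zero, sub_zero] at e3
    have n0 := theta00_zero_ne_zero hσ
    have n1 := theta01_zero_ne_zero hσ
    have n2 := theta10_zero_ne_zero hσ
    have m0 := theta00_zero_ne_zero hσ2
    have m1 := theta01_zero_ne_zero hσ2
    have m2 := theta10_zero_ne_zero hσ2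
    simp only [D]
    rw [div_eq_div_iff (by positivity) (by positivity), e2]
    refine mul_right_cancel₀ n2 ?_
    linear_combination (varThetaDerivZero (2 * σ) * theta01 (2 * σ) 0 ^ 2) * e3 -
      (theta00 (2 * σ) 0 * theta01 (2 * σ) 0 * theta10 (2 * σ) 0) * e1
  have hlim : Tendsto D (comap im atTop) (𝓝 (2 * Real.pi * I / (1 * 1 * 2))) := by
    refine (tendsto_varThetaDerivZero.div ((tendsto_theta00.mul tendsto_theta01).mul
      tendsto_theta10) (by norm_num)).congr fun σ => ?_
    simp only [D]
    rw [Pi.div_apply, mul_left_comm, mul_div_mul_left _ _ (Complex.exp_ne_zero _)]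
  have h := hlim.comp (tendsto_two_pow_mul hτ)
  simp only [Function.comp_def, hD] at h
  have h1 : D τ = I * Real.pi := by
    rw [tendsto_nhds_unique tendsto_const_nhds h]
    ring
  have n0 := theta00_zero_ne_zero hτ
  have n1 := theta01_zero_ne_zero hτ
  have n2 := theta10_zero_ne_zero hτ
  rw [← h1]
  simp only [D]
  field_simp

lemma varThetaDerivZero_ne_zero {τ : ℂ} (hτ : 0 < τ.im) : varThetaDerivZero τ ≠ 0 := by
  rw [varThetaDerivZero_eq_mul hτ]
  have n0 := theta00_zero_ne_zero hτ
  have n1 := theta01_zero_ne_zero hτ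
  have n2 := theta10_zero_ne_zero hτ
  have := Real.pi_ne_zero
  simp [*]

/-! ### Wronskians of theta functions -/

/-- Entire functions form an integral domain. This permits cancelling a theta function even at its
zeros. -/
lemma eq_zero_of_mul_eq_zero_of_ne {f g : ℂ → ℂ} (hf : Differentiable ℂ f)
    (hg : Differentiable ℂ g) (h : ∀ z, f z * g z = 0) {w : ℂ} (hw : f w ≠ 0) (z : ℂ) :
    g z = 0 := by
  rcases AnalyticOnNhd.eq_zero_or_eq_zero_of_smul_eq_zero (U := Set.univ)
    (fun z _ => hf.analyticAt z) (fun z _ => hg.analyticAt z) (fun z _ => h z)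
    isPreconnected_univ with h | h
  · exact absurd (h w trivial) hw
  · exact h z trivial

lemma differentiable_deriv {f : ℂ → ℂ} (hf : Differentiable ℂ f) : Differentiable ℂ (deriv f) :=
  fun z => (hf.analyticAt z).deriv.differentiableAt

/-- Differentiate the addition formula in y at y = 0. The even functions have derivative 0 there, so
only ϑ'(0) remains on the right; Jacobi's formula evaluates it. -/
lemma wronskian_varTheta_theta01 {τ : ℂ} (hτ : 0 < τ.im) (z : ℂ) :
    deriv (varTheta τ) z * theta01 τ z - varTheta τ z * deriv (theta01 τ) z =
      I * Real.pi * theta01 τ 0 ^ 2 * (theta00 τ z * theta10 τ z) := by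
  have h : (fun y => varTheta τ (z + y) * theta01 τ (z - y) * (theta00 τ 0 * theta10 τ 0)) =
      fun y => varTheta τ z * theta01 τ z * (theta00 τ y * theta10 τ y) +
        varTheta τ y * theta01 τ y * (theta00 τ z * theta10 τ z) :=
    funext (varTheta_add_mul_theta01_sub hτ z)
  have d1 : HasDerivAt (fun y => varTheta τ (z + y)) (deriv (varTheta τ) (z + 0)) 0 :=
    HasDerivAt.comp_const_add z 0 (differentiable_varTheta hτ _).hasDerivAt
  have d2 : HasDerivAt (fun y => theta01 τ (z - y)) (-deriv (theta01 τ) (z - 0)) 0 :=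
    HasDerivAt.comp_const_sub z 0 (differentiable_theta01 hτ _).hasDerivAt
  have hz0 : ∀ f : ℂ → ℂ, (∀ x, f (-x) = f x) → Differentiable ℂ f → deriv f 0 = 0 := by
    intro f hf hd
    have h1 : HasDerivAt (fun y => f (0 - y)) (-deriv f (0 - 0)) 0 :=
      HasDerivAt.comp_const_sub 0 0 (hd _).hasDerivAt
    simp only [zero_sub, hf, neg_zero] at h1
    exact CharZero.eq_neg_self_iff.mp ((hd 0).hasDerivAt.unique h1)
  have e0 : HasDerivAt (theta00 τ) 0 0 := by
    have := (differentiable_theta00 hτ 0).hasDerivAt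
    rwa [hz0 _ (theta00_neg τ) (differentiable_theta00 hτ)] at this
  have e1 : HasDerivAt (theta01 τ) 0 0 := by
    have := (differentiable_theta01 hτ 0).hasDerivAt
    rwa [hz0 _ (theta01_neg τ) (differentiable_theta01 hτ)] at this
  have e2 : HasDerivAt (theta10 τ) 0 0 := by
    have := (differentiable_theta10 hτ 0).hasDerivAt
    rwa [hz0 _ (theta10_neg τ) (differentiable_theta10 hτ)] at this
  have l := (d1.fun_mul d2).mul_const (theta00 τ 0 * theta10 τ 0)
  have r := ((e0.fun_mul e2).const_mul (varTheta τ z * theta01 τ z)).fun_add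
    (((hasDerivAt_varTheta_zero hτ).fun_mul e1).mul_const (theta00 τ z * theta10 τ z))
  have := l.unique (r.congr_of_eventuallyEq (.of_eq h))
  rw [varThetaDerivZero_eq_mul hτ] at this
  simp only [add_zero, sub_zero] at this
  refine mul_right_cancel₀ (mul_ne_zero (theta00_zero_ne_zero hτ) (theta10_zero_ne_zero hτ)) ?_
  linear_combination this

/-- Differentiating the quadratic relation between θ₀₁, θ₁₀ and ϑ and inserting the previous
Wronskian yields the claim multiplied by θ₁₀(z), which is then cancelled. -/
lemma wronskian_theta10_theta01 {τ : ℂ} (hτ : 0 < τ.im) (z : ℂ) :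
    deriv (theta10 τ) z * theta01 τ z - theta10 τ z * deriv (theta01 τ) z =
      I * Real.pi * theta00 τ 0 ^ 2 * (theta00 τ z * varTheta τ z) := by
  have D0 := differentiable_theta00 hτ
  have D1 := differentiable_theta01 hτ
  have D2 := differentiable_theta10 hτ
  have D3 := differentiable_varTheta hτ
  have D1' := differentiable_deriv D1
  have D2' := differentiable_deriv D2
  rw [← sub_eq_zero]
  refine eq_zero_of_mul_eq_zero_of_ne (f := theta10 τ) (g := fun z =>
    deriv (theta10 τ) z * theta01 τ z - theta10 τ z * deriv (theta01 τ) z -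
      I * Real.pi * theta00 τ 0 ^ 2 * (theta00 τ z * varTheta τ z)) D2 (by fun_prop) (fun z => ?_)
    (theta10_zero_ne_zero hτ) z
  have h : (fun z => theta01 τ z ^ 2 * theta10 τ 0 ^ 2) = fun z =>
      theta10 τ z ^ 2 * theta01 τ 0 ^ 2 - varTheta τ z ^ 2 * theta00 τ 0 ^ 2 :=
    funext (theta01_sq_mul_theta10_sq hτ)
  have l := ((D1 z).hasDerivAt.fun_pow 2).mul_const (theta10 τ 0 ^ 2)
  have r := (((D2 z).hasDerivAt.fun_pow 2).mul_const (theta01 τ 0 ^ 2)).fun_sub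
    (((D3 z).hasDerivAt.fun_pow 2).mul_const (theta00 τ 0 ^ 2))
  have e := l.unique (r.congr_of_eventuallyEq (.of_eq h))
  norm_num at e
  refine (mul_eq_zero.mp ?_).resolve_left (pow_ne_zero 2 (theta01_zero_ne_zero hτ))
  linear_combination (-theta01 τ z / 2) * e + deriv (theta01 τ) z * theta01_sq_mul_theta10_sq hτ z
    + theta00 τ 0 ^ 2 * varTheta τ z * wronskian_varTheta_theta01 hτ z

lemma wronskian_theta00_theta01 {τ : ℂ} (hτ : 0 < τ.im) (z : ℂ) :
    deriv (theta00 τ) z * theta01 τ z - theta00 τ z * deriv (theta01 τ) z =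
      I * Real.pi * theta10 τ 0 ^ 2 * (theta10 τ z * varTheta τ z) := by
  have D0 := differentiable_theta00 hτ
  have D1 := differentiable_theta01 hτ
  have D2 := differentiable_theta10 hτ
  have D3 := differentiable_varTheta hτ
  have D1' := differentiable_deriv D1
  have D0' := differentiable_deriv D0
  rw [← sub_eq_zero]
  refine eq_zero_of_mul_eq_zero_of_ne (f := theta00 τ) (g := fun z =>
    deriv (theta00 τ) z * theta01 τ z - theta00 τ z * deriv (theta01 τ) z -
      I * Real.pi * theta10 τ 0 ^ 2 * (theta10 τ z * varTheta τ z)) D0 (by fun_prop) (fun z => ?_)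
    (theta00_zero_ne_zero hτ) z
  have h : (fun z => theta01 τ z ^ 2 * theta00 τ 0 ^ 2) = fun z =>
      theta00 τ z ^ 2 * theta01 τ 0 ^ 2 - varTheta τ z ^ 2 * theta10 τ 0 ^ 2 :=
    funext (theta01_sq_mul_theta00_sq hτ)
  have l := ((D1 z).hasDerivAt.fun_pow 2).mul_const (theta00 τ 0 ^ 2)
  have r := (((D0 z).hasDerivAt.fun_pow 2).mul_const (theta01 τ 0 ^ 2)).fun_sub
    (((D3 z).hasDerivAt.fun_pow 2).mul_const (theta10 τ 0 ^ 2))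
  have e := l.unique (r.congr_of_eventuallyEq (.of_eq h))
  norm_num at e
  refine (mul_eq_zero.mp ?_).resolve_left (pow_ne_zero 2 (theta01_zero_ne_zero hτ))
  linear_combination (-theta01 τ z / 2) * e + deriv (theta01 τ) z * theta01_sq_mul_theta00_sq hτ z
    + theta10 τ 0 ^ 2 * varTheta τ z * wronskian_varTheta_theta01 hτ z

/-! ### No common zeros -/

/-- At a common zero z the addition formula would make θ₀₁(z + y)θ₀₁(z - y) vanish for all y,
although θ₀₁(0) ≠ 0. -/
lemma varTheta_ne_zero_of_theta01_eq_zero {τ z : ℂ} (hτ : 0 < τ.im) (hz : theta01 τ z = 0) :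
    varTheta τ z ≠ 0 := by
  intro h
  have D1 := differentiable_theta01 hτ
  have h1 : ∀ y, theta01 τ (z + y) * theta01 τ (z - y) = 0 := fun y => by
    have := theta01_add_mul_theta01_sub hτ z y
    rw [hz, h] at this
    simpa [theta01_zero_ne_zero hτ] using this
  have h2 := eq_zero_of_mul_eq_zero_of_ne (f := fun y => theta01 τ (z + y))
    (g := fun y => theta01 τ (z - y)) (by fun_prop) (by fun_prop) h1 (w := -z)
    (by simpa using theta01_zero_ne_zero hτ) z
  rw [sub_self] at h2
  exact theta01_zero_ne_zero hτ h2

lemma theta10_ne_zero_of_theta01_eq_zero {τ z : ℂ} (hτ : 0 < τ.im) (hz : theta01 τ z = 0) :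
    theta10 τ z ≠ 0 := by
  intro h
  have h2 := theta01_sq_mul_theta10_sq hτ z
  rw [hz, h] at h2
  have := varTheta_ne_zero_of_theta01_eq_zero hτ hz
  simp [this, theta00_zero_ne_zero hτ] at h2

lemma theta00_ne_zero_of_theta01_eq_zero {τ z : ℂ} (hτ : 0 < τ.im) (hz : theta01 τ z = 0) :
    theta00 τ z ≠ 0 := by
  intro h
  have h2 := theta01_sq_mul_theta00_sq hτ z
  rw [hz, h] at h2
  have := varTheta_ne_zero_of_theta01_eq_zero hτ hz
  simp [this, theta10_zero_ne_zero hτ] at h2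

/-! ### The Jacobi functions as theta quotients -/

/-- The period `π θ₀₀(0)²`. -/
def thetaPeriod (τ : ℂ) : ℂ := Real.pi * theta00 τ 0 ^ 2

lemma thetaPeriod_ne_zero {τ : ℂ} (hτ : 0 < τ.im) : thetaPeriod τ ≠ 0 :=
  mul_ne_zero (by exact_mod_cast Real.pi_ne_zero) (pow_ne_zero 2 (theta00_zero_ne_zero hτ))

/-- The theta quotient that represents `sn u`. -/
def thetaSn (τ u : ℂ) : ℂ :=
  -I * theta00 τ 0 / theta10 τ 0 * varTheta τ (u / thetaPeriod τ) / theta01 τ (u / thetaPeriod τ)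

/-- The theta quotient that represents `cn u`. -/
def thetaCn (τ u : ℂ) : ℂ :=
  theta01 τ 0 / theta10 τ 0 * theta10 τ (u / thetaPeriod τ) / theta01 τ (u / thetaPeriod τ)

/-- The theta quotient that represents `dn u`. -/
def thetaDn (τ u : ℂ) : ℂ :=
  theta01 τ 0 / theta00 τ 0 * theta00 τ (u / thetaPeriod τ) / theta01 τ (u / thetaPeriod τ)

/-- The modulus `θ₁₀(0)² / θ₀₀(0)²`. -/
def thetaModulus (τ : ℂ) : ℂ := theta10 τ 0 ^ 2 / theta00 τ 0 ^ 2

lemma hasDerivAt_theta_quotient {τ : ℂ} (hτ : 0 < τ.im) {f : ℂ → ℂ} (hf : Differentiable ℂ f)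
    (a : ℂ) {u : ℂ} (hu : theta01 τ (u / thetaPeriod τ) ≠ 0) :
    HasDerivAt (fun u => a * f (u / thetaPeriod τ) / theta01 τ (u / thetaPeriod τ))
      (a * (deriv f (u / thetaPeriod τ) * theta01 τ (u / thetaPeriod τ) -
        f (u / thetaPeriod τ) * deriv (theta01 τ) (u / thetaPeriod τ)) /
        (thetaPeriod τ * theta01 τ (u / thetaPeriod τ) ^ 2)) u := by
  have h0 : HasDerivAt (fun u => u / thetaPeriod τ) (1 / thetaPeriod τ) u :=
    (hasDerivAt_id u).div_const _
  have h1 := ((hf (u / thetaPeriod τ)).hasDerivAt.comp u h0).const_mul a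
  have h2 := ((differentiable_theta01 hτ) (u / thetaPeriod τ)).hasDerivAt.comp u h0
  refine (h1.fun_div h2 hu).congr_deriv ?_
  have := thetaPeriod_ne_zero hτ
  simp only [Function.comp_apply]
  field_simp

lemma hasDerivAt_thetaSn {τ u : ℂ} (hτ : 0 < τ.im) (hu : theta01 τ (u / thetaPeriod τ) ≠ 0) :
    HasDerivAt (thetaSn τ) (thetaCn τ u * thetaDn τ u) u := by
  refine (hasDerivAt_theta_quotient hτ (differentiable_varTheta hτ) _ hu).congr_deriv ?_
  rw [wronskian_varTheta_theta01 hτ, thetaCn, thetaDn]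
  generalize hz : u / thetaPeriod τ = z at *
  rw [thetaPeriod]
  have n0 := theta00_zero_ne_zero hτ
  have n2 := theta10_zero_ne_zero hτ
  have hpi : (Real.pi : ℂ) ≠ 0 := by exact_mod_cast Real.pi_ne_zero
  field_simp
  linear_combination (-(theta01 τ 0 ^ 2 * theta00 τ z * theta10 τ z)) * I_sq

lemma hasDerivAt_thetaCn {τ u : ℂ} (hτ : 0 < τ.im) (hu : theta01 τ (u / thetaPeriod τ) ≠ 0) :
    HasDerivAt (thetaCn τ) (-(thetaSn τ u * thetaDn τ u)) u := by
  refine (hasDerivAt_theta_quotient hτ (differentiable_theta10 hτ) _ hu).congr_deriv ?_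
  rw [wronskian_theta10_theta01 hτ, thetaSn, thetaDn]
  generalize hz : u / thetaPeriod τ = z at *
  rw [thetaPeriod]
  have n0 := theta00_zero_ne_zero hτ
  have n2 := theta10_zero_ne_zero hτ
  have hpi : (Real.pi : ℂ) ≠ 0 := by exact_mod_cast Real.pi_ne_zero
  field_simp

lemma hasDerivAt_thetaDn {τ u : ℂ} (hτ : 0 < τ.im) (hu : theta01 τ (u / thetaPeriod τ) ≠ 0) :
    HasDerivAt (thetaDn τ) (-(thetaModulus τ ^ 2 * thetaSn τ u * thetaCn τ u)) u := by
  refine (hasDerivAt_theta_quotient hτ (differentiable_theta00 hτ) _ hu).congr_deriv ?_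
  rw [wronskian_theta00_theta01 hτ, thetaSn, thetaCn, thetaModulus]
  generalize hz : u / thetaPeriod τ = z at *
  rw [thetaPeriod]
  have n0 := theta00_zero_ne_zero hτ
  have n2 := theta10_zero_ne_zero hτ
  have hpi : (Real.pi : ℂ) ≠ 0 := by exact_mod_cast Real.pi_ne_zero
  field_simp

lemma codiscrete_comp_div_ne_zero {f : ℂ → ℂ} (hf : Differentiable ℂ f) {w : ℂ} (hw : f w ≠ 0)
    {a : ℂ} (ha : a ≠ 0) : {u : ℂ | f (u / a) ≠ 0} ∈ codiscrete ℂ := by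
  have h : Differentiable ℂ fun u => f (u / a) := hf.comp (by fun_prop)
  exact AnalyticOnNhd.preimage_zero_mem_codiscrete (x := w * a) (fun z _ => h.analyticAt z)
    (by rwa [mul_div_cancel_right₀ _ ha])

/-- `IsJacobiTriple` asks for the equations wherever the functions are analytic, so zeros of the
denominator must be excluded there. Near such a zero, quotient times denominator would tend to 0,
while the numerator does not. -/
lemma theta01_ne_zero_of_analyticAt {τ : ℂ} (hτ : 0 < τ.im) {f : ℂ → ℂ}
    (hf : Differentiable ℂ f) {a : ℂ} (ha : a ≠ 0)
    (hne : ∀ z, theta01 τ z = 0 → f z ≠ 0) {u : ℂ}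
    (h : AnalyticAt ℂ (fun u => a * f (u / thetaPeriod τ) / theta01 τ (u / thetaPeriod τ)) u) :
    theta01 τ (u / thetaPeriod τ) ≠ 0 := by
  intro h0
  have hev : ∀ᶠ v in 𝓝[≠] u, theta01 τ (v / thetaPeriod τ) ≠ 0 := by
    have := codiscrete_comp_div_ne_zero (differentiable_theta01 hτ) (theta01_zero_ne_zero hτ)
      (thetaPeriod_ne_zero hτ)
    have h := mem_codiscreteWithin_iff_forall_mem_nhdsNE.mp this u trivial
    rwa [Set.compl_univ, Set.union_empty] at h
  have c1 : ContinuousAt (fun u => theta01 τ (u / thetaPeriod τ)) u :=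
    ((differentiable_theta01 hτ).continuous.comp (by fun_prop)).continuousAt
  have c2 : ContinuousAt (fun u => a * f (u / thetaPeriod τ)) u :=
    (continuous_const.mul (hf.continuous.comp (by fun_prop))).continuousAt
  have t1 := (h.continuousAt.mul c1).tendsto.mono_left (nhdsWithin_le_nhds (s := {u}ᶜ))
  have t2 := c2.tendsto.mono_left (nhdsWithin_le_nhds (s := {u}ᶜ))
  have := tendsto_nhds_unique (t1.congr' (hev.mono fun v hv => div_mul_cancel₀ _ hv)) t2
  simp only [Pi.mul_apply, h0, mul_zero] at this
  exact mul_ne_zero ha (hne _ h0) this.symm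

lemma meromorphicNFOn_theta_quotient {τ : ℂ} (hτ : 0 < τ.im) {f : ℂ → ℂ}
    (hf : Differentiable ℂ f) {a : ℂ} (ha : a ≠ 0) (hne : ∀ z, theta01 τ z = 0 → f z ≠ 0) :
    MeromorphicNFOn (fun u => a * f (u / thetaPeriod τ) / theta01 τ (u / thetaPeriod τ))
      Set.univ := by
  intro u _
  have hf' : Differentiable ℂ fun u => a * f (u / thetaPeriod τ) :=
    (hf.comp (by fun_prop : Differentiable ℂ fun u => u / thetaPeriod τ)).const_mul a
  have hg : Differentiable ℂ fun u => theta01 τ (u / thetaPeriod τ) :=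
    (differentiable_theta01 hτ).comp (by fun_prop)
  refine MeromorphicNFOn.div (hf'.analyticAt u) (hg.analyticAt u).meromorphicNFAt ?_
  by_cases h : theta01 τ (u / thetaPeriod τ) = 0
  · exact .inr (mul_ne_zero ha (hne _ h))
  · exact .inl h

lemma thetaSn_coeff_ne_zero {τ : ℂ} (hτ : 0 < τ.im) : -I * theta00 τ 0 / theta10 τ 0 ≠ 0 :=
  div_ne_zero (mul_ne_zero (neg_ne_zero.mpr I_ne_zero) (theta00_zero_ne_zero hτ))
    (theta10_zero_ne_zero hτ)

theorem isJacobiTriple_theta {τ : ℂ} (hτ : 0 < τ.im) :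
    IsJacobiTriple (thetaModulus τ) (thetaSn τ) (thetaCn τ) (thetaDn τ) := by
  have n0 := theta00_zero_ne_zero hτ
  have n1 := theta01_zero_ne_zero hτ
  have n2 := theta10_zero_ne_zero hτ
  have hs := thetaSn_coeff_ne_zero hτ
  have an : ∀ f : ℂ → ℂ, Differentiable ℂ f → ∀ a, AnalyticAt ℂ
      (fun u => a * f (u / thetaPeriod τ) / theta01 τ (u / thetaPeriod τ)) 0 := by
    intro f hf a
    have hf' : Differentiable ℂ fun u => a * f (u / thetaPeriod τ) :=
      (hf.comp (by fun_prop : Differentiable ℂ fun u => u / thetaPeriod τ)).const_mul a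
    have hg : Differentiable ℂ fun u => theta01 τ (u / thetaPeriod τ) :=
      (differentiable_theta01 hτ).comp (by fun_prop)
    exact (hf'.analyticAt 0).div (hg.analyticAt 0) (by simpa using n1)
  exact
    { meromorphic_s := meromorphicNFOn_theta_quotient hτ (differentiable_varTheta hτ) hs
        fun _ => varTheta_ne_zero_of_theta01_eq_zero hτ
      meromorphic_c := meromorphicNFOn_theta_quotient hτ (differentiable_theta10 hτ)
        (div_ne_zero n1 n2) fun _ => theta10_ne_zero_of_theta01_eq_zero hτ
      meromorphic_d := meromorphicNFOn_theta_quotient hτ (differentiable_theta00 hτ)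
        (div_ne_zero n1 n0) fun _ => theta00_ne_zero_of_theta01_eq_zero hτ
      analyticAt_zero_s := an _ (differentiable_varTheta hτ) _
      analyticAt_zero_c := an _ (differentiable_theta10 hτ) _
      analyticAt_zero_d := an _ (differentiable_theta00 hτ) _
      s_zero := by simp [thetaSn, varTheta_zero]
      c_zero := by
        rw [thetaCn, zero_div]
        field_simp
      d_zero := by
        rw [thetaDn, zero_div]
        field_simp
      ode := fun u h _ _ => by
        have := theta01_ne_zero_of_analyticAt hτ (differentiable_varTheta hτ) hs
          (fun _ => varTheta_ne_zero_of_theta01_eq_zero hτ) h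
        exact ⟨hasDerivAt_thetaSn hτ this, hasDerivAt_thetaCn hτ this, hasDerivAt_thetaDn hτ this⟩ }

/-! ### Uniqueness of the Jacobi functions -/

lemma natCast_le_analyticOrderAt_combination {a b u v : ℂ → ℂ} {z : ℂ} {n : ℕ}
    (ha : AnalyticAt ℂ a z) (hb : AnalyticAt ℂ b z) (hu : AnalyticAt ℂ u z)
    (hv : AnalyticAt ℂ v z) (hna : n ≤ analyticOrderAt a z) (hnb : n ≤ analyticOrderAt b z) :
    n ≤ analyticOrderAt (a * u + v * b) z := by
  refine le_trans (le_min ?_ ?_) le_analyticOrderAt_add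
  · rw [analyticOrderAt_mul ha hu]
    exact le_add_right hna
  · rw [analyticOrderAt_mul hv hb]
    exact le_add_left hnb

lemma eventually_analyticAt_deriv {k : ℂ} {s c d : ℂ → ℂ} (h : IsJacobiTriple k s c d) :
    deriv s =ᶠ[𝓝 0] c * d ∧ deriv c =ᶠ[𝓝 0] -(s * d) ∧
      deriv d =ᶠ[𝓝 0] fun u => -(k ^ 2 * s u * c u) := by
  have h1 := h.analyticAt_zero_s.eventually_analyticAt
  have h2 := h.analyticAt_zero_c.eventually_analyticAt
  have h3 := h.analyticAt_zero_d.eventually_analyticAt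
  refine ⟨?_, ?_, ?_⟩
  · filter_upwards [h1, h2, h3] with u a b c using (h.ode u a b c).1.deriv
  · filter_upwards [h1, h2, h3] with u a b c using (h.ode u a b c).2.1.deriv
  · filter_upwards [h1, h2, h3] with u a b c using (h.ode u a b c).2.2.deriv

/-- The derivatives of the three differences are combinations of the differences with analytic
coefficients. If all vanish to order n, so do the derivatives; as the differences are 0 at the
origin, their order is at least n + 1. -/
lemma IsJacobiTriple.analyticOrderAt_sub {k : ℂ} {s₁ c₁ d₁ s₂ c₂ d₂ : ℂ → ℂ}
    (h₁ : IsJacobiTriple k s₁ c₁ d₁) (h₂ : IsJacobiTriple k s₂ c₂ d₂) (n : ℕ) :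
    n ≤ analyticOrderAt (s₁ - s₂) 0 ∧ n ≤ analyticOrderAt (c₁ - c₂) 0 ∧
      n ≤ analyticOrderAt (d₁ - d₂) 0 := by
  have as₁ := h₁.analyticAt_zero_s
  have ac₁ := h₁.analyticAt_zero_c
  have ad₁ := h₁.analyticAt_zero_d
  have as₂ := h₂.analyticAt_zero_s
  have ac₂ := h₂.analyticAt_zero_c
  have ad₂ := h₂.analyticAt_zero_d
  have as := as₁.sub as₂
  have ac := ac₁.sub ac₂
  have ad := ad₁.sub ad₂
  obtain ⟨es₁, ec₁, ed₁⟩ := eventually_analyticAt_deriv h₁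
  obtain ⟨es₂, ec₂, ed₂⟩ := eventually_analyticAt_deriv h₂
  have hd : ∀ {f g : ℂ → ℂ}, AnalyticAt ℂ f 0 → AnalyticAt ℂ g 0 →
      deriv (f - g) =ᶠ[𝓝 0] deriv f - deriv g := by
    intro f g hf hg
    filter_upwards [hf.eventually_analyticAt, hg.eventually_analyticAt] with u a b
    exact deriv_sub a.differentiableAt b.differentiableAt
  induction n with
  | zero => simp
  | succ n ih =>
    obtain ⟨is, ic, id⟩ := ih
    have z1 : (s₁ - s₂) 0 = 0 := by simp [h₁.s_zero, h₂.s_zero]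
    have z2 : (c₁ - c₂) 0 = 0 := by simp [h₁.c_zero, h₂.c_zero]
    have z3 : (d₁ - d₂) 0 = 0 := by simp [h₁.d_zero, h₂.d_zero]
    push_cast
    rw [← analyticOrderAt_deriv_ge_iff as z1, ← analyticOrderAt_deriv_ge_iff ac z2,
      ← analyticOrderAt_deriv_ge_iff ad z3]
    refine ⟨?_, ?_, ?_⟩
    · have : deriv (s₁ - s₂) =ᶠ[𝓝 0] (c₁ - c₂) * d₁ + c₂ * (d₁ - d₂) := by
        filter_upwards [hd as₁ as₂, es₁, es₂] with u e0 e1 e2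
        simp only [e0, Pi.sub_apply, Pi.add_apply, Pi.mul_apply, e1, e2]
        ring
      rw [analyticOrderAt_congr this]
      exact natCast_le_analyticOrderAt_combination ac ad ad₁ ac₂ ic id
    · have : deriv (c₁ - c₂) =ᶠ[𝓝 0] (s₁ - s₂) * (-d₁) + (-s₂) * (d₁ - d₂) := by
        filter_upwards [hd ac₁ ac₂, ec₁, ec₂] with u e0 e1 e2
        simp only [e0, Pi.sub_apply, Pi.add_apply, Pi.mul_apply, Pi.neg_apply, e1, e2]
        ring
      rw [analyticOrderAt_congr this]
      exact natCast_le_analyticOrderAt_combination as ad ad₁.neg as₂.neg is id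
    · have : deriv (d₁ - d₂) =ᶠ[𝓝 0] (s₁ - s₂) * (fun u => -k ^ 2 * c₁ u) +
          (fun u => -k ^ 2 * s₂ u) * (c₁ - c₂) := by
        filter_upwards [hd ad₁ ad₂, ed₁, ed₂] with u e0 e1 e2
        simp only [e0, Pi.sub_apply, Pi.add_apply, Pi.mul_apply, e1, e2]
        ring
      rw [analyticOrderAt_congr this]
      exact natCast_le_analyticOrderAt_combination as ac (analyticAt_const.mul ac₁)
        (analyticAt_const.mul as₂) is ic

/-- Infinite order of f - g at one point spreads over the connected plane; the normal form upgrades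
equality off a point to equality at it, poles included. -/
lemma eq_of_meromorphicNFOn {f g : ℂ → ℂ} (hf : MeromorphicNFOn f Set.univ)
    (hg : MeromorphicNFOn g Set.univ) {w : ℂ} (h : f =ᶠ[𝓝 w] g) : f = g := by
  have hm : MeromorphicOn (f - g) Set.univ := hf.meromorphicOn.sub hg.meromorphicOn
  have htop : ∀ u : ℂ, meromorphicOrderAt (f - g) u = ⊤ := by
    by_contra! hu
    obtain ⟨u, hu⟩ := hu
    have := (hm.exists_meromorphicOrderAt_ne_top_iff_forall isConnected_univ).mp
      ⟨⟨u, trivial⟩, hu⟩ ⟨w, trivial⟩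
    refine this (meromorphicOrderAt_eq_top_iff.mpr ?_)
    filter_upwards [h.filter_mono nhdsWithin_le_nhds] with z hz
    simp [hz]
  funext u
  have h1 := meromorphicOrderAt_eq_top_iff.mp (htop u)
  have h2 : f =ᶠ[𝓝[≠] u] g := h1.mono fun z hz => sub_eq_zero.mp hz
  exact (((hf trivial).eventuallyEq_nhdsNE_iff_eventuallyEq_nhds (hg trivial)).mp h2).eq_of_nhds

theorem IsJacobiTriple.unique {k : ℂ} {s₁ c₁ d₁ s₂ c₂ d₂ : ℂ → ℂ}
    (h₁ : IsJacobiTriple k s₁ c₁ d₁) (h₂ : IsJacobiTriple k s₂ c₂ d₂) :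
    s₁ = s₂ ∧ c₁ = c₂ ∧ d₁ = d₂ := by
  have key : ∀ {f g : ℂ → ℂ}, (∀ n : ℕ, n ≤ analyticOrderAt (f - g) 0) → f =ᶠ[𝓝 0] g := by
    intro f g h
    have : analyticOrderAt (f - g) 0 = ⊤ := ENat.eq_top_iff_forall_ge.mpr h
    exact (analyticOrderAt_eq_top.mp this).mono fun z hz => sub_eq_zero.mp hz
  have h := h₁.analyticOrderAt_sub h₂
  exact ⟨eq_of_meromorphicNFOn h₁.meromorphic_s h₂.meromorphic_s (key fun n => (h n).1),
    eq_of_meromorphicNFOn h₁.meromorphic_c h₂.meromorphic_c (key fun n => (h n).2.1),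
    eq_of_meromorphicNFOn h₁.meromorphic_d h₂.meromorphic_d (key fun n => (h n).2.2)⟩

lemma isJacobiTriple_jacobiTriple {k : ℂ} {s c d : ℂ → ℂ} (h : IsJacobiTriple k s c d) :
    IsJacobiTriple k (sn k) (cn k) (dn k) :=
  Classical.epsilon_spec (p := fun t : (ℂ → ℂ) × (ℂ → ℂ) × (ℂ → ℂ) =>
    IsJacobiTriple k t.1 t.2.1 t.2.2) ⟨(s, c, d), h⟩

lemma jacobi_eq_theta {τ : ℂ} (hτ : 0 < τ.im) :
    sn (thetaModulus τ) = thetaSn τ ∧ cn (thetaModulus τ) = thetaCn τ ∧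
      dn (thetaModulus τ) = thetaDn τ :=
  (isJacobiTriple_jacobiTriple (isJacobiTriple_theta hτ)).unique (isJacobiTriple_theta hτ)

/-! ### The modulus as a function of the modular parameter -/

/-- The complementary modulus `θ₀₁(0)² / θ₀₀(0)²`. -/
def thetaComodulus (τ : ℂ) : ℂ := theta01 τ 0 ^ 2 / theta00 τ 0 ^ 2

lemma thetaModulus_ne_zero {τ : ℂ} (hτ : 0 < τ.im) : thetaModulus τ ≠ 0 :=
  div_ne_zero (pow_ne_zero 2 (theta10_zero_ne_zero hτ)) (pow_ne_zero 2 (theta00_zero_ne_zero hτ))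

lemma thetaComodulus_ne_zero {τ : ℂ} (hτ : 0 < τ.im) : thetaComodulus τ ≠ 0 :=
  div_ne_zero (pow_ne_zero 2 (theta01_zero_ne_zero hτ)) (pow_ne_zero 2 (theta00_zero_ne_zero hτ))

lemma thetaComodulus_sq {τ : ℂ} (hτ : 0 < τ.im) :
    thetaComodulus τ ^ 2 = 1 - thetaModulus τ ^ 2 := by
  have n0 := theta00_zero_ne_zero hτ
  rw [thetaComodulus, thetaModulus]
  field_simp
  linear_combination -theta00_pow_four hτ

/-- The parity of n² - n gives exp(πi n²) = (-1)ⁿ. -/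
lemma theta00_period_add_one (τ : ℂ) : theta00 (τ + 1) 0 = theta01 τ 0 := by
  refine tsum_congr fun n => ?_
  rw [← exp_int_mul_pi_mul_I, ← Complex.exp_add, Complex.exp_eq_exp_iff_exists_int]
  obtain ⟨m, hm⟩ := Int.even_mul_succ_self (n - 1)
  refine ⟨m, ?_⟩
  have hm' : ((n : ℂ) - 1) * ((n : ℂ) - 1 + 1) = m + m := by exact_mod_cast hm
  linear_combination (Real.pi * I) * hm'

lemma theta01_period_add_one (τ : ℂ) : theta01 (τ + 1) 0 = theta00 τ 0 := by
  refine tsum_congr fun n => ?_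
  rw [← exp_int_mul_pi_mul_I, ← Complex.exp_add, Complex.exp_eq_exp_iff_exists_int]
  obtain ⟨m, hm⟩ := Int.even_mul_succ_self n
  refine ⟨m, ?_⟩
  have hm' : (n : ℂ) * ((n : ℂ) + 1) = m + m := by exact_mod_cast hm
  linear_combination (Real.pi * I) * hm'

lemma theta10_period_add_one (τ : ℂ) :
    theta10 (τ + 1) 0 = cexp (Real.pi * I / 4) * theta10 τ 0 := by
  rw [theta10, theta10, ← tsum_mul_left]
  refine tsum_congr fun n => ?_
  rw [← Complex.exp_add, Complex.exp_eq_exp_iff_exists_int]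
  obtain ⟨m, hm⟩ := Int.even_mul_succ_self n
  refine ⟨m, ?_⟩
  have hm' : (n : ℂ) * ((n : ℂ) + 1) = m + m := by exact_mod_cast hm
  linear_combination (Real.pi * I) * hm'

lemma thetaModulus_add_one {τ : ℂ} (hτ : 0 < τ.im) :
    thetaModulus (τ + 1) = I * thetaModulus τ / thetaComodulus τ := by
  have n0 := theta00_zero_ne_zero hτ
  have n1 := theta01_zero_ne_zero hτ
  have h : cexp (Real.pi * I / 4) ^ 2 = I := by
    rw [← Complex.exp_nat_mul, show ((2 : ℕ) : ℂ) * (Real.pi * I / 4) = Real.pi / 2 * I by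
      push_cast; ring, exp_pi_div_two_mul_I]
  rw [thetaModulus, thetaModulus, thetaComodulus, theta00_period_add_one, theta10_period_add_one,
    mul_pow, h]
  field_simp

lemma thetaComodulus_add_one (τ : ℂ) : thetaComodulus (τ + 1) = 1 / thetaComodulus τ := by
  rw [thetaComodulus, thetaComodulus, theta00_period_add_one, theta01_period_add_one, one_div_div]

lemma im_neg_one_div_pos {τ : ℂ} (hτ : 0 < τ.im) : 0 < (-1 / τ).im := by
  have h0 : τ ≠ 0 := fun h => by simp [h] at hτ
  rw [neg_div, one_div, Complex.neg_im, Complex.inv_im, neg_div, neg_neg]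
  exact div_pos hτ (Complex.normSq_pos.mpr h0)

/-- Inversion of τ exchanges θ₀₁ and θ₁₀ at 0 and fixes θ₀₀, up to a common factor that cancels in
the ratio. -/
lemma thetaComodulus_eq {τ : ℂ} (hτ : 0 < τ.im) :
    thetaComodulus τ = thetaModulus (-1 / τ) := by
  have h0 : τ ≠ 0 := fun h => by simp [h] at hτ
  have hc : 1 / (-I * τ) ^ (1 / 2 : ℂ) ≠ 0 := by
    refine one_div_ne_zero fun h => ?_
    rw [Complex.cpow_eq_zero_iff] at h
    exact mul_ne_zero (neg_ne_zero.mpr I_ne_zero) h0 h.1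
  have e0 : theta00 τ 0 = 1 / (-I * τ) ^ (1 / 2 : ℂ) * theta00 (-1 / τ) 0 := by
    rw [theta00_eq, theta00_eq, jacobiTheta₂_functional_equation]
    simp
  have e1 : theta01 τ 0 = 1 / (-I * τ) ^ (1 / 2 : ℂ) * theta10 (-1 / τ) 0 := by
    rw [theta01_eq, theta10_eq, jacobiTheta₂_functional_equation, mul_assoc,
      ← jacobiTheta₂_neg_left]
    congr 3
    · field_simp
      ring
    · field_simp
      ring
  rw [thetaComodulus, thetaModulus, e0, e1, mul_pow, mul_pow,
    mul_div_mul_left _ _ (pow_ne_zero 2 hc)]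

lemma thetaComodulus_neg_one_div {τ : ℂ} (hτ : 0 < τ.im) :
    thetaComodulus (-1 / τ) = thetaModulus τ := by
  rw [thetaComodulus_eq (im_neg_one_div_pos hτ), neg_div, neg_div, div_neg, neg_neg, one_div_one_div]

lemma thetaModulus_sq_add_one {τ : ℂ} (hτ : 0 < τ.im) :
    thetaModulus (τ + 1) ^ 2 = thetaModulus τ ^ 2 / (thetaModulus τ ^ 2 - 1) := by
  rw [thetaModulus_add_one hτ, div_pow, mul_pow, I_sq, thetaComodulus_sq hτ, ← neg_sub (1 : ℂ),
    div_neg]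
  ring

lemma thetaModulus_sq_neg_one_div {τ : ℂ} (hτ : 0 < τ.im) :
    thetaModulus (-1 / τ) ^ 2 = 1 - thetaModulus τ ^ 2 := by
  rw [← thetaComodulus_eq hτ, thetaComodulus_sq hτ]

/-- The absolute invariant, up to a constant factor, as a function of `λ = k²`. -/
def anharmonicInvariant (x : ℂ) : ℂ := (x ^ 2 - x + 1) ^ 3 / (x ^ 2 * (1 - x) ^ 2)

lemma anharmonicInvariant_one_sub (x : ℂ) :
    anharmonicInvariant (1 - x) = anharmonicInvariant x := by
  rw [anharmonicInvariant, anharmonicInvariant]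
  ring_nf

lemma anharmonicInvariant_div_sub_one {x : ℂ} (h0 : x ≠ 0) (h1 : 1 - x ≠ 0) :
    anharmonicInvariant (x / (x - 1)) = anharmonicInvariant x := by
  have h2 : x - 1 ≠ 0 := fun h => h1 (by linear_combination -h)
  have h3 : 1 - x / (x - 1) = -1 / (x - 1) := by
    field_simp
    ring
  have h4 : (x / (x - 1)) ^ 2 - x / (x - 1) + 1 = (x ^ 2 - x + 1) / (x - 1) ^ 2 := by
    field_simp
    ring
  rw [anharmonicInvariant, anharmonicInvariant, h3, h4]
  field_simp
  ring

/-- The cleared equation has degree six in y and splits into linear factors: the roots are the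
anharmonic orbit x, 1 - x, x/(x - 1), 1/x, (x - 1)/x, 1/(1 - x). -/
lemma eq_or_of_anharmonicInvariant_eq {x y : ℂ} (hx0 : x ≠ 0) (hx1 : 1 - x ≠ 0) (hy0 : y ≠ 0)
    (hy1 : 1 - y ≠ 0) (h : anharmonicInvariant x = anharmonicInvariant y) :
    y = x ∨ y = 1 - x ∨ y * (x - 1) = x ∨ y * x = 1 ∨ y * x = x - 1 ∨ y * (1 - x) = 1 := by
  rw [anharmonicInvariant, anharmonicInvariant, div_eq_div_iff (by positivity) (by positivity)] at h
  have : (y - x) * ((y - (1 - x)) * ((y * (x - 1) - x) * ((y * x - 1) *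
      ((y * x - (x - 1)) * (y * (1 - x) - 1))))) = 0 := by
    linear_combination h
  simpa only [mul_eq_zero, sub_eq_zero] using this

/-- The absolute invariant, up to a constant factor, as a function of the modular parameter. -/
def thetaInvariant (τ : ℂ) : ℂ := anharmonicInvariant (thetaModulus τ ^ 2)

lemma one_sub_thetaModulus_sq_ne_zero {τ : ℂ} (hτ : 0 < τ.im) : 1 - thetaModulus τ ^ 2 ≠ 0 := by
  rw [← thetaComodulus_sq hτ]
  exact pow_ne_zero 2 (thetaComodulus_ne_zero hτ)

lemma thetaInvariant_add_one {τ : ℂ} (hτ : 0 < τ.im) :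
    thetaInvariant (τ + 1) = thetaInvariant τ := by
  rw [thetaInvariant, thetaModulus_sq_add_one hτ, anharmonicInvariant_div_sub_one
    (pow_ne_zero 2 (thetaModulus_ne_zero hτ)) (one_sub_thetaModulus_sq_ne_zero hτ), thetaInvariant]

lemma thetaInvariant_neg_one_div {τ : ℂ} (hτ : 0 < τ.im) :
    thetaInvariant (-1 / τ) = thetaInvariant τ := by
  rw [thetaInvariant, thetaModulus_sq_neg_one_div hτ, anharmonicInvariant_one_sub, thetaInvariant]

open UpperHalfPlane ModularGroup in
lemma thetaInvariant_smul (g : Matrix.SpecialLinearGroup (Fin 2) ℤ) (τ : ℍ) :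
    thetaInvariant ((g • τ : ℍ) : ℂ) = thetaInvariant τ := by
  have hg : g ∈ Subgroup.closure {S, T} := by
    simp [SpecialLinearGroup.SL2Z_generators]
  induction hg using Subgroup.closure_induction generalizing τ with
  | mem x hx =>
    rcases hx with rfl | rfl
    · rw [modular_S_smul, ← thetaInvariant_neg_one_div τ.im_pos]
      congr 1
      simp [inv_neg, neg_div]
    · rw [modular_T_smul, ← thetaInvariant_add_one τ.im_pos]
      congr 1
      simp [add_comm]
  | one => rw [one_smul]
  | mul x y _ _ hx hy => rw [mul_smul, hx, hy]
  | inv x _ hx => rw [← hx, smul_inv_smul]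

/-- Eliminating θ₁₀ leaves two values of `jacobiTheta₂` at fixed first argument, from which
holomorphy in τ and the limit at the cusp are immediate. -/
lemma thetaModulus_sq_eq {τ : ℂ} (hτ : 0 < τ.im) :
    thetaModulus τ ^ 2 = 1 - (jacobiTheta₂ (1 / 2) τ / jacobiTheta₂ 0 τ) ^ 4 := by
  have h := thetaComodulus_sq hτ
  rw [thetaComodulus, theta00_eq, theta01_eq, zero_add] at h
  linear_combination h

lemma isOpen_im_pos : IsOpen {τ : ℂ | 0 < τ.im} := isOpen_lt continuous_const Complex.continuous_im

lemma differentiableOn_thetaModulus_sq :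
    DifferentiableOn ℂ (fun τ => thetaModulus τ ^ 2) {τ | 0 < τ.im} := by
  refine DifferentiableOn.congr (f := fun τ =>
    1 - (jacobiTheta₂ (1 / 2) τ / jacobiTheta₂ 0 τ) ^ 4) ?_ fun τ hτ => thetaModulus_sq_eq hτ
  intro τ hτ
  have h0 : jacobiTheta₂ 0 τ ≠ 0 := by
    rw [← theta00_eq]
    exact theta00_zero_ne_zero hτ
  have d0 := differentiableAt_jacobiTheta₂_snd 0 hτ
  have d1 := differentiableAt_jacobiTheta₂_snd (1 / 2) hτ
  exact (((d1.fun_div d0 h0).fun_pow 4).const_sub 1).differentiableWithinAt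

lemma differentiableOn_thetaInvariant : DifferentiableOn ℂ thetaInvariant {τ | 0 < τ.im} := by
  have h := differentiableOn_thetaModulus_sq
  refine DifferentiableOn.fun_div (by fun_prop) (by fun_prop) fun τ hτ => ?_
  exact mul_ne_zero (pow_ne_zero 2 (pow_ne_zero 2 (thetaModulus_ne_zero hτ)))
    (pow_ne_zero 2 (one_sub_thetaModulus_sq_ne_zero hτ))

lemma eventually_im_pos : ∀ᶠ τ : ℂ in comap im atTop, 0 < τ.im :=
  tendsto_comap.eventually (eventually_gt_atTop (0 : ℝ))

lemma tendsto_thetaModulus_sq : Tendsto (fun τ => thetaModulus τ ^ 2) (comap im atTop) (𝓝 0) := by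
  have h : Tendsto (fun τ => 1 - (theta01 τ 0 / theta00 τ 0) ^ 4) (comap im atTop)
      (𝓝 (1 - (1 / 1) ^ 4)) :=
    ((tendsto_theta01.div tendsto_theta00 one_ne_zero).pow 4).const_sub 1
  norm_num only at h
  refine h.congr' ?_
  filter_upwards [eventually_im_pos] with τ hτ
  rw [thetaModulus_sq_eq hτ, theta00_eq, theta01_eq, zero_add]

lemma tendsto_norm_thetaInvariant :
    Tendsto (fun τ => ‖thetaInvariant τ‖) (comap im atTop) atTop := by
  have h := tendsto_thetaModulus_sq
  have hn : Tendsto (fun τ => ‖((thetaModulus τ ^ 2) ^ 2 - thetaModulus τ ^ 2 + 1) ^ 3‖)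
      (comap im atTop) (𝓝 1) := by
    simpa using ((((h.pow 2).sub h).add_const 1).pow 3).norm
  have hd : Tendsto (fun τ => (thetaModulus τ ^ 2) ^ 2 * (1 - thetaModulus τ ^ 2) ^ 2)
      (comap im atTop) (𝓝[≠] 0) := by
    refine tendsto_nhdsWithin_iff.mpr ⟨?_, ?_⟩
    · simpa using (h.pow 2).mul ((h.const_sub 1).pow 2)
    · filter_upwards [eventually_im_pos] with τ hτ
      exact mul_ne_zero (pow_ne_zero 2 (pow_ne_zero 2 (thetaModulus_ne_zero hτ)))
        (pow_ne_zero 2 (one_sub_thetaModulus_sq_ne_zero hτ))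
  have hi := tendsto_norm_cobounded_atTop.comp (tendsto_inv₀_nhdsNE_zero.comp hd)
  refine (hn.pos_mul_atTop one_pos hi).congr fun τ => ?_
  rw [thetaInvariant, anharmonicInvariant, div_eq_mul_inv, norm_mul]
  rfl

open UpperHalfPlane in
-- The image of the half-plane is nonempty, open by the open mapping theorem (blow-up at the cusp
-- excludes a constant), and closed, so it is all of the connected plane.
lemma thetaInvariant_surjective (w : ℂ) : ∃ τ : ℂ, 0 < τ.im ∧ thetaInvariant τ = w := by
  set U : Set ℂ := {τ | 0 < τ.im} with hU
  have hopen : IsOpen (thetaInvariant '' U) := by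
    have han : AnalyticOnNhd ℂ thetaInvariant U :=
      differentiableOn_thetaInvariant.analyticOnNhd isOpen_im_pos
    rcases han.is_constant_or_isOpen (convex_halfSpace_im_gt 0).isPreconnected with ⟨a, ha⟩ | h
    · have hne : (comap im atTop : Filter ℂ).NeBot :=
        comap_neBot_iff_frequently.mpr (Frequently.of_forall fun y => ⟨y * Complex.I, by simp⟩)
      have h1 : ∀ᶠ τ in comap im atTop, ‖a‖ < ‖thetaInvariant τ‖ :=
        tendsto_norm_thetaInvariant.eventually (eventually_gt_atTop _)
      obtain ⟨τ, h1, h2⟩ := (h1.and eventually_im_pos).exists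
      rw [ha τ h2] at h1
      exact absurd h1 (lt_irrefl _)
    · exact h U subset_rfl isOpen_im_pos
  have hclosed : closure (thetaInvariant '' U) ∩ Set.univ ⊆ thetaInvariant '' U := by
    rintro v ⟨hv, -⟩
    -- Values within distance 1 of v are not attained high up. Reduced to the fundamental domain,
    -- their preimages stay below a fixed height, and v lies in the closure of a compact image.
    have h1 : ∀ᶠ τ in comap im atTop, ‖v‖ + 1 < ‖thetaInvariant τ‖ :=
      tendsto_norm_thetaInvariant.eventually (eventually_gt_atTop _)
    rw [eventually_comap] at h1
    obtain ⟨Y, hY⟩ := eventually_atTop.mp h1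
    set K : Set ℂ := thetaInvariant '' (UpperHalfPlane.coe ''
      ModularGroup.truncatedFundamentalDomain Y) with hK
    have hsub : UpperHalfPlane.coe '' ModularGroup.truncatedFundamentalDomain Y ⊆ U := by
      rintro _ ⟨τ, -, rfl⟩
      exact τ.im_pos
    have hKc : IsCompact K := by
      refine ((ModularGroup.isCompact_truncatedFundamentalDomain Y).image
        UpperHalfPlane.continuous_coe).image_of_continuousOn ?_
      exact differentiableOn_thetaInvariant.continuousOn.mono hsub
    have hKU : K ⊆ thetaInvariant '' U := Set.image_mono hsub
    refine hKU (hKc.isClosed.closure_subset (mem_closure_iff_nhds.mpr fun N hN => ?_))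
    obtain ⟨x, ⟨hxN, hxb⟩, τ, hτ, rfl⟩ := mem_closure_iff_nhds.mp hv (N ∩ Metric.ball v 1)
      (inter_mem hN (Metric.ball_mem_nhds v one_pos))
    obtain ⟨g, hg⟩ := ModularGroup.exists_smul_mem_fd (⟨τ, hτ⟩ : ℍ)
    refine ⟨_, hxN, _, ⟨_, ⟨hg, ?_⟩, rfl⟩, thetaInvariant_smul g ⟨τ, hτ⟩⟩
    by_contra! hlt
    have h2 := hY _ hlt.le (g • (⟨τ, hτ⟩ : ℍ) : ℍ) rfl
    rw [thetaInvariant_smul] at h2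
    rw [mem_ball_iff_norm] at hxb
    have h3 := norm_sub_norm_le (thetaInvariant τ) v
    have h2' : ‖v‖ + 1 < ‖thetaInvariant τ‖ := h2
    linarith
  have := isPreconnected_univ.subset_of_closure_inter_subset hopen
    ⟨thetaInvariant Complex.I, trivial, Complex.I, by simp [hU], rfl⟩ hclosed
  obtain ⟨τ, hτ, h⟩ := this (Set.mem_univ w)
  exact ⟨τ, hτ, h⟩

/-- Any τ with the right invariant has λ(τ) in the anharmonic orbit of x. With S inversion and T
translation, the six cases are corrected by 1, S, T, STS, TS, ST. -/
lemma exists_thetaModulus_sq {x : ℂ} (hx0 : x ≠ 0) (hx1 : 1 - x ≠ 0) :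
    ∃ τ : ℂ, 0 < τ.im ∧ thetaModulus τ ^ 2 = x := by
  obtain ⟨τ, hτ, h⟩ := thetaInvariant_surjective (anharmonicInvariant x)
  have hT : ∀ {σ : ℂ}, 0 < σ.im → 0 < (σ + 1).im := fun h => by simpa using h
  have hS : ∀ {σ : ℂ}, 0 < σ.im → 0 < (-1 / σ).im := im_neg_one_div_pos
  have n0 : thetaModulus τ ^ 2 ≠ 0 := pow_ne_zero 2 (thetaModulus_ne_zero hτ)
  have n1 := one_sub_thetaModulus_sq_ne_zero hτ
  have n2 : thetaModulus τ ^ 2 - 1 ≠ 0 := fun h => n1 (by linear_combination -h)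
  have n3 : 1 - thetaModulus τ ^ 2 - 1 ≠ 0 := fun h => n0 (by linear_combination -h)
  rcases eq_or_of_anharmonicInvariant_eq n0 n1 hx0 hx1 h with e | e | e | e | e | e
  · exact ⟨τ, hτ, e.symm⟩
  · exact ⟨-1 / τ, hS hτ, by rw [thetaModulus_sq_neg_one_div hτ, e]⟩
  · exact ⟨τ + 1, hT hτ, by rw [thetaModulus_sq_add_one hτ, ← eq_div_iff n2 |>.mpr e]⟩
  · refine ⟨-1 / (-1 / τ + 1), hS (hT (hS hτ)), ?_⟩
    rw [thetaModulus_sq_neg_one_div (hT (hS hτ)), thetaModulus_sq_add_one (hS hτ),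
      thetaModulus_sq_neg_one_div hτ, eq_div_iff n0 |>.mpr e]
    generalize thetaModulus τ ^ 2 = y at *
    field_simp
    ring
  · refine ⟨-1 / τ + 1, hT (hS hτ), ?_⟩
    rw [thetaModulus_sq_add_one (hS hτ), thetaModulus_sq_neg_one_div hτ, eq_div_iff n0 |>.mpr e]
    generalize thetaModulus τ ^ 2 = y at *
    field_simp
    ring
  · refine ⟨-1 / (τ + 1), hS (hT hτ), ?_⟩
    rw [thetaModulus_sq_neg_one_div (hT hτ), thetaModulus_sq_add_one hτ, eq_div_iff n1 |>.mpr e]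
    field_simp
    ring

lemma thetaModulus_add_two {τ : ℂ} (hτ : 0 < τ.im) :
    thetaModulus (τ + 1 + 1) = -thetaModulus τ := by
  have h1 : 0 < (τ + 1).im := by simpa using hτ
  have := thetaComodulus_ne_zero hτ
  rw [thetaModulus_add_one h1, thetaModulus_add_one hτ, thetaComodulus_add_one]
  field_simp
  linear_combination thetaModulus τ * I_sq

lemma thetaComodulus_add_two (τ : ℂ) : thetaComodulus (τ + 1 + 1) = thetaComodulus τ := by
  rw [thetaComodulus_add_one, thetaComodulus_add_one, one_div_one_div]

/-- The map `τ ↦ (θ₁₀² / θ₀₀², θ₀₁² / θ₀₀²)` is onto the curve `k² + κ² = 1`, `k κ ≠ 0`. -/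
theorem exists_thetaModulus_thetaComodulus {k κ : ℂ} (hk : k ≠ 0) (hκ : κ ≠ 0)
    (h : κ ^ 2 = 1 - k ^ 2) :
    ∃ τ : ℂ, 0 < τ.im ∧ thetaModulus τ = k ∧ thetaComodulus τ = κ := by
  have hT : ∀ {σ : ℂ}, 0 < σ.im → 0 < (σ + 1 + 1).im := fun h => by simpa using h
  have h1 : ∃ τ : ℂ, 0 < τ.im ∧ thetaModulus τ = k := by
    obtain ⟨τ, hτ, h1⟩ := exists_thetaModulus_sq (pow_ne_zero 2 hk)
      (by rw [← h]; exact pow_ne_zero 2 hκ)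
    rcases sq_eq_sq_iff_eq_or_eq_neg.mp h1 with e | e
    · exact ⟨τ, hτ, e⟩
    -- The translation by 2 reverses the sign of k.
    · exact ⟨_, hT hτ, by rw [thetaModulus_add_two hτ, e, neg_neg]⟩
  obtain ⟨τ, hτ, rfl⟩ := h1
  rcases sq_eq_sq_iff_eq_or_eq_neg.mp (h.trans (thetaComodulus_sq hτ).symm) with e | e
  · exact ⟨τ, hτ, rfl, e.symm⟩
  -- Conjugating the translation by 2 with the inversion, which swaps the two moduli, reverses κ and
  -- keeps k.
  · have hS := im_neg_one_div_pos hτ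
    refine ⟨-1 / (-1 / τ + 1 + 1), im_neg_one_div_pos (hT hS), ?_, ?_⟩
    · rw [← thetaComodulus_eq (hT hS), thetaComodulus_add_two, thetaComodulus_neg_one_div hτ]
    · rw [thetaComodulus_neg_one_div (hT hS), thetaModulus_add_two hS, ← thetaComodulus_eq hτ, e]

/-! ### Zeros of the odd theta function -/

lemma exists_varTheta_ne_zero {τ : ℂ} (hτ : 0 < τ.im) : ∃ w, varTheta τ w ≠ 0 := by
  by_contra! h
  have : varTheta τ = fun _ => 0 := funext h
  have h0 := varThetaDerivZero_ne_zero hτ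
  rw [varThetaDerivZero, this, deriv_const] at h0
  exact h0 rfl

lemma eq_add_mul_of_im_pos {τ : ℂ} (hτ : 0 < τ.im) (z : ℂ) : ∃ a b : ℝ, z = a + b * τ := by
  refine ⟨z.re - z.im / τ.im * τ.re, z.im / τ.im, ?_⟩
  apply Complex.ext
  · simp
  · simp [hτ.ne']

lemma exists_bound_of_periodic {F : ℂ → ℂ} {τ : ℂ} (hτ : 0 < τ.im) (hF : Continuous F)
    (h1 : ∀ z, ‖F (z + 1)‖ = ‖F z‖) (h2 : ∀ z, ‖F (z + τ)‖ = ‖F z‖) : ∃ C, ∀ z, ‖F z‖ ≤ C := by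
  have hK : IsCompact ((fun p : ℝ × ℝ => (p.1 : ℂ) + p.2 * τ) ''
      (Set.Icc 0 1 ×ˢ Set.Icc 0 1)) :=
    (isCompact_Icc.prod isCompact_Icc).image (by fun_prop)
  obtain ⟨C, hC⟩ := hK.exists_bound_of_continuousOn hF.continuousOn
  refine ⟨C, fun z => ?_⟩
  obtain ⟨a, b, rfl⟩ := eq_add_mul_of_im_pos hτ z
  have p1 : Function.Periodic (fun z => ‖F z‖) 1 := h1
  have p2 : Function.Periodic (fun z => ‖F z‖) τ := h2
  have e1 := p1.int_mul ⌊a⌋ (Int.fract a + Int.fract b * τ)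
  have e2 := p2.int_mul ⌊b⌋ (Int.fract a + Int.fract b * τ + ⌊a⌋ * 1)
  have e : (a : ℂ) + b * τ = Int.fract a + Int.fract b * τ + ⌊a⌋ * 1 + ⌊b⌋ * τ := by
    have ha : (a : ℂ) = ⌊a⌋ + Int.fract a := by exact_mod_cast (Int.floor_add_fract a).symm
    have hb : (b : ℂ) = ⌊b⌋ + Int.fract b := by exact_mod_cast (Int.floor_add_fract b).symm
    linear_combination ha + hb * τ
  rw [e]
  refine (e2.trans e1).le.trans (hC _ ⟨(Int.fract a, Int.fract b), ⟨?_, ?_⟩, rfl⟩)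
  · exact ⟨Int.fract_nonneg _, (Int.fract_lt_one _).le⟩
  · exact ⟨Int.fract_nonneg _, (Int.fract_lt_one _).le⟩

/-- Liouville's theorem for entire functions with two periods up to unimodular factors. -/
lemma apply_eq_apply_of_periodic {F : ℂ → ℂ} {τ : ℂ} (hτ : 0 < τ.im) (hF : Differentiable ℂ F)
    (h1 : ∀ z, ‖F (z + 1)‖ = ‖F z‖) (h2 : ∀ z, ‖F (z + τ)‖ = ‖F z‖) (z w : ℂ) : F z = F w := by
  obtain ⟨C, hC⟩ := exists_bound_of_periodic hτ hF.continuous h1 h2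
  refine hF.apply_eq_apply_of_bounded (isBounded_iff_forall_norm_le.mpr ⟨C, ?_⟩) z w
  rintro _ ⟨y, rfl⟩
  exact hC y

/-- The quotient ϑ(z₀ + y)/ϑ(y) is entire: as ϑ(z₀) = 0, the first addition formula rewrites it as
cθ₀₁(y)/θ₀₁(z₀ - y), and the second shows that this denominator is nonzero wherever ϑ(y) = 0. -/
lemma exists_differentiable_mul_varTheta {τ z₀ : ℂ} (hτ : 0 < τ.im) (hz : varTheta τ z₀ = 0) :
    ∃ R : ℂ → ℂ, Differentiable ℂ R ∧ ∀ y, varTheta τ y * R y = varTheta τ (z₀ + y) := by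
  classical
  have D1 := differentiable_theta01 hτ
  have D3 := differentiable_varTheta hτ
  have C1 := D1.continuous
  have n0 := theta00_zero_ne_zero hτ
  have n1 := theta01_zero_ne_zero hτ
  have n2 := theta10_zero_ne_zero hτ
  have n3 : theta01 τ z₀ ≠ 0 := fun h => varTheta_ne_zero_of_theta01_eq_zero hτ h hz
  set c : ℂ := theta00 τ z₀ * theta10 τ z₀ / (theta00 τ 0 * theta10 τ 0) with hc
  have e1 : ∀ y, varTheta τ (z₀ + y) * theta01 τ (z₀ - y) =
      varTheta τ y * (c * theta01 τ y) := fun y => by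
    have := varTheta_add_mul_theta01_sub hτ z₀ y
    rw [hz] at this
    rw [hc]
    field_simp
    linear_combination this
  have e2 : ∀ y, varTheta τ y = 0 → theta01 τ (z₀ - y) ≠ 0 := fun y hy h => by
    have := theta01_add_mul_theta01_sub hτ z₀ y
    have hy1 : theta01 τ y ≠ 0 := fun h => varTheta_ne_zero_of_theta01_eq_zero hτ h hy
    rw [hz, h] at this
    simp [n3, hy1] at this
  let R : ℂ → ℂ := fun y => if varTheta τ y = 0 then c * theta01 τ y / theta01 τ (z₀ - y)
    else varTheta τ (z₀ + y) / varTheta τ y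
  refine ⟨R, fun y => ?_, fun y => ?_⟩
  · by_cases hy : varTheta τ y = 0
    · have hd : DifferentiableAt ℂ (fun y => c * theta01 τ y / theta01 τ (z₀ - y)) y :=
        DifferentiableAt.fun_div (by fun_prop) (by fun_prop) (e2 y hy)
      refine hd.congr_of_eventuallyEq ?_
      have hev : ∀ᶠ w in 𝓝 y, theta01 τ (z₀ - w) ≠ 0 :=
        (by fun_prop : Continuous fun w => theta01 τ (z₀ - w)).continuousAt.eventually_ne (e2 y hy)
      filter_upwards [hev] with w hw
      simp only [R]
      split_ifs with h
      · rfl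
      · rw [div_eq_div_iff h hw, e1]
        ring
    · have hd : DifferentiableAt ℂ (fun y => varTheta τ (z₀ + y) / varTheta τ y) y :=
        DifferentiableAt.fun_div (by fun_prop) (by fun_prop) hy
      refine hd.congr_of_eventuallyEq ?_
      filter_upwards [D3.continuous.continuousAt.eventually_ne hy] with w hw
      simp only [R, if_neg hw]
  · simp only [R]
    split_ifs with h
    · have := e1 y
      rw [h, zero_mul] at this
      rw [h, zero_mul, (mul_eq_zero.mp this).resolve_right (e2 y h)]
    · rw [mul_div_cancel₀ _ h]

lemma varTheta_eq_zero_iff {τ z : ℂ} (hτ : 0 < τ.im) :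
    varTheta τ z = 0 ↔ ∃ m n : ℤ, z = m + n * τ := by
  constructor
  · intro hz
    obtain ⟨R, hR, hRv⟩ := exists_differentiable_mul_varTheta hτ hz
    obtain ⟨w, hw⟩ := exists_varTheta_ne_zero hτ
    have D3 := differentiable_varTheta hτ
    have R1 : ∀ y, R (y + 1) = R y := fun y => by
      rw [← sub_eq_zero]
      refine eq_zero_of_mul_eq_zero_of_ne (g := fun y => R (y + 1) - R y) D3 (by fun_prop)
        (fun y => ?_) hw y
      have := hRv (y + 1)
      rw [← add_assoc, varTheta_add_one, varTheta_add_one] at this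
      linear_combination -this - hRv y
    have R2 : ∀ y, R (y + τ) = cexp (-(2 * Real.pi * I * z)) * R y := fun y => by
      rw [← sub_eq_zero]
      refine eq_zero_of_mul_eq_zero_of_ne
        (g := fun y => R (y + τ) - cexp (-(2 * Real.pi * I * z)) * R y) D3 (by fun_prop)
        (fun y => ?_) hw y
      have := hRv (y + τ)
      rw [← add_assoc, varTheta_add_tau, varTheta_add_tau,
        show -(Real.pi : ℂ) * I * (τ + 2 * (z + y)) =
          -(2 * Real.pi * I * z) + -Real.pi * I * (τ + 2 * y) by ring, Complex.exp_add] at this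
      refine mul_left_cancel₀ (Complex.exp_ne_zero (-Real.pi * I * (τ + 2 * y))) ?_
      linear_combination -this - (cexp (-(2 * Real.pi * I * z)) *
        cexp (-Real.pi * I * (τ + 2 * y))) * hRv y
    -- R has multipliers 1 and exp(-2πiz) along 1 and τ. For z = a + bτ with real a, b, the factor
    -- exp(2πiby) makes both unimodular, so the product is constant; its multipliers exp(2πib) and
    -- exp(-2πia) are then 1, and a, b are integers.
    obtain ⟨a, b, hab⟩ := eq_add_mul_of_im_pos hτ z
    have hconst := apply_eq_apply_of_periodic (F := fun y => R y * cexp (2 * Real.pi * I * b * y))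
      hτ (by fun_prop) (fun y => by
        rw [R1, mul_add, Complex.exp_add, norm_mul, norm_mul, norm_mul,
          show 2 * (Real.pi : ℂ) * I * b * 1 = ((2 * Real.pi * b : ℝ) : ℂ) * I by push_cast; ring,
          Complex.norm_exp_ofReal_mul_I, mul_one]) (fun y => by
        rw [R2, mul_right_comm, ← Complex.exp_add, mul_comm, norm_mul, norm_mul,
          show -(2 * (Real.pi : ℂ) * I * z) + 2 * Real.pi * I * b * (y + τ) =
            ((-(2 * Real.pi * a) : ℝ) : ℂ) * I + 2 * Real.pi * I * b * y by
              rw [hab]; push_cast; ring,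
          Complex.exp_add, norm_mul, Complex.norm_exp_ofReal_mul_I, one_mul])
    have hR0 : R 0 ≠ 0 := by
      intro h0
      have hR' : ∀ y, R y = 0 := fun y => by
        have := hconst y 0
        rw [h0, zero_mul] at this
        exact (mul_eq_zero.mp this).resolve_right (Complex.exp_ne_zero _)
      have := hRv (w - z)
      rw [hR', mul_zero, add_sub_cancel] at this
      exact hw this.symm
    have c1 := hconst 1 0
    have c2 := hconst τ 0
    have r1 := R1 0
    have r2 := R2 0
    rw [zero_add] at r1 r2
    rw [r1] at c1
    rw [r2, mul_right_comm, ← Complex.exp_add, mul_comm (cexp _)] at c2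
    have c1' := mul_left_cancel₀ hR0 c1
    have c2' := mul_left_cancel₀ hR0 c2
    rw [mul_zero, Complex.exp_zero, Complex.exp_eq_one_iff] at c1' c2'
    obtain ⟨n, hn⟩ := c1'
    obtain ⟨m, hm⟩ := c2'
    have h2pi := Complex.two_pi_I_ne_zero
    refine ⟨-m, n, mul_left_cancel₀ h2pi ?_⟩
    push_cast
    linear_combination -hm + τ * hn
  · rintro ⟨m, n, rfl⟩
    have p1 : ∀ z, varTheta τ z = 0 ↔ varTheta τ (z + 1) = 0 := fun z => by
      rw [varTheta_add_one, neg_eq_zero]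
    have p2 : ∀ z, varTheta τ z = 0 ↔ varTheta τ (z + τ) = 0 := fun z => by
      rw [varTheta_add_tau, neg_mul, neg_eq_zero, mul_eq_zero]
      simp [Complex.exp_ne_zero]
    have q1 : Function.Periodic (fun z => varTheta τ z = 0) 1 := fun z => propext (p1 z).symm
    have q2 : Function.Periodic (fun z => varTheta τ z = 0) τ := fun z => propext (p2 z).symm
    have e := (q2.int_mul n (m * 1)).trans (by simpa using q1.int_mul m 0)
    simp only [mul_one, varTheta_zero, eq_iff_iff, iff_true] at e
    exact e

/-! ### The Weierstrass function -/

lemma eventually_theta01_ne_zero {τ : ℂ} (hτ : 0 < τ.im) :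
    ∀ᶠ u in 𝓝 (0 : ℂ), theta01 τ (u / thetaPeriod τ) ≠ 0 := by
  have C1 := (differentiable_theta01 hτ).continuous
  refine (by fun_prop : Continuous fun u => theta01 τ (u / thetaPeriod τ)).continuousAt.eventually_ne
    ?_
  rw [zero_div]
  exact theta01_zero_ne_zero hτ

lemma thetaCn_sq {τ u : ℂ} (hτ : 0 < τ.im) (hu : theta01 τ (u / thetaPeriod τ) ≠ 0) :
    thetaCn τ u ^ 2 = 1 - thetaSn τ u ^ 2 := by
  have n2 := theta10_zero_ne_zero hτ
  rw [thetaCn, thetaSn]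
  field_simp
  linear_combination -theta01_sq_mul_theta10_sq hτ (u / thetaPeriod τ) +
    theta00 τ 0 ^ 2 * varTheta τ (u / thetaPeriod τ) ^ 2 * I_sq

lemma thetaDn_sq {τ u : ℂ} (hτ : 0 < τ.im) (hu : theta01 τ (u / thetaPeriod τ) ≠ 0) :
    thetaDn τ u ^ 2 = 1 - thetaModulus τ ^ 2 * thetaSn τ u ^ 2 := by
  have n2 := theta10_zero_ne_zero hτ
  have n0 := theta00_zero_ne_zero hτ
  rw [thetaDn, thetaSn, thetaModulus]
  field_simp
  linear_combination -theta01_sq_mul_theta00_sq hτ (u / thetaPeriod τ) +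
    theta10 τ 0 ^ 2 * varTheta τ (u / thetaPeriod τ) ^ 2 * I_sq

/-- The first and second derivatives of sn u - u vanish at 0, whence the factor u³. The value m(0)
comes from the first-order equation, without a third derivative. -/
lemma exists_thetaSn_eq {τ : ℂ} (hτ : 0 < τ.im) :
    ∃ m : ℂ → ℂ, AnalyticAt ℂ m 0 ∧ 6 * m 0 = -(1 + thetaModulus τ ^ 2) ∧
      ∀ᶠ u in 𝓝 (0 : ℂ), thetaSn τ u = u + u ^ 3 * m u := by
  have hJ := isJacobiTriple_theta hτ
  have as := hJ.analyticAt_zero_s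
  have ac := hJ.analyticAt_zero_c
  have ad := hJ.analyticAt_zero_d
  have s0 := hJ.s_zero
  have c0 := hJ.c_zero
  have d0 := hJ.d_zero
  have hne := eventually_theta01_ne_zero hτ
  set k := thetaModulus τ
  let f : ℂ → ℂ := fun u => thetaSn τ u - u
  have af : AnalyticAt ℂ f 0 := as.sub analyticAt_id
  have df : deriv f =ᶠ[𝓝 0] fun u => thetaCn τ u * thetaDn τ u - 1 := by
    filter_upwards [hne] with u hu
    exact ((hasDerivAt_thetaSn hτ hu).sub (hasDerivAt_id u)).deriv
  have ddf : deriv (deriv f) =ᶠ[𝓝 0] fun u => -(thetaSn τ u * thetaDn τ u) * thetaDn τ u +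
      thetaCn τ u * -(k ^ 2 * thetaSn τ u * thetaCn τ u) := by
    refine df.deriv.trans ?_
    filter_upwards [hne] with u hu
    exact (((hasDerivAt_thetaCn hτ hu).mul (hasDerivAt_thetaDn hτ hu)).sub_const 1).deriv
  have f0 : f 0 = 0 := by simp [f, s0]
  have df0 : deriv f 0 = 0 := by
    rw [df.eq_of_nhds, c0, d0]
    ring
  have ddf0 : deriv (deriv f) 0 = 0 := by
    rw [ddf.eq_of_nhds, s0]
    ring
  have o1 : ((1 : ℕ) : ℕ∞) ≤ analyticOrderAt (deriv (deriv f)) 0 := by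
    rw [Nat.cast_one, Order.one_le_iff_ne_zero, af.deriv.deriv.analyticOrderAt_ne_zero]
    exact ddf0
  have o3 : ((3 : ℕ) : ℕ∞) ≤ analyticOrderAt f 0 := by
    rw [show ((3 : ℕ) : ℕ∞) = ((2 : ℕ) : ℕ∞) + 1 by norm_num,
      ← analyticOrderAt_deriv_ge_iff af f0, show ((2 : ℕ) : ℕ∞) = ((1 : ℕ) : ℕ∞) + 1 by norm_num,
      ← analyticOrderAt_deriv_ge_iff af.deriv df0]
    exact o1
  obtain ⟨m, am, hm⟩ := (natCast_le_analyticOrderAt af).mp o3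
  have hsm : ∀ᶠ u in 𝓝 (0 : ℂ), thetaSn τ u = u + u ^ 3 * m u := by
    filter_upwards [hm] with u hu
    simp only [f, sub_zero, smul_eq_mul] at hu
    linear_combination hu
  refine ⟨m, am, ?_, hsm⟩
  -- This is (sn')² - 1 = -(1 + k²)sn² + k²sn⁴ divided by u², with sn' - 1 = u²(3m + um'). At u → 0
  -- it gives 6m(0) = -(1 + k²).
  have key : ∀ᶠ u in 𝓝[≠] (0 : ℂ),
      (3 * m u + u * deriv m u) * (thetaCn τ u * thetaDn τ u + 1) =
        -(1 + k ^ 2) * (1 + u ^ 2 * m u) ^ 2 + k ^ 2 * thetaSn τ u ^ 2 * (1 + u ^ 2 * m u) ^ 2 := by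
    filter_upwards [hne.filter_mono nhdsWithin_le_nhds, hsm.filter_mono nhdsWithin_le_nhds,
      hsm.eventually_nhds.filter_mono nhdsWithin_le_nhds,
      am.eventually_analyticAt.filter_mono nhdsWithin_le_nhds, self_mem_nhdsWithin] with u h1 h2 h3 h4 h5
    have hd := (hasDerivAt_id u).add ((hasDerivAt_pow 3 u).mul h4.differentiableAt.hasDerivAt)
    have he := (hasDerivAt_thetaSn hτ h1).unique (hd.congr_of_eventuallyEq h3)
    have hc := thetaCn_sq hτ h1
    have hd := thetaDn_sq hτ h1
    have hu : u ^ 2 ≠ 0 := pow_ne_zero 2 h5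
    norm_num at he
    refine mul_left_cancel₀ hu ?_
    rw [show u ^ 2 * ((3 * m u + u * deriv m u) * (thetaCn τ u * thetaDn τ u + 1)) =
      (thetaCn τ u * thetaDn τ u - 1) * (thetaCn τ u * thetaDn τ u + 1) by rw [he]; ring,
      show u ^ 2 * (-(1 + k ^ 2) * (1 + u ^ 2 * m u) ^ 2 +
        k ^ 2 * thetaSn τ u ^ 2 * (1 + u ^ 2 * m u) ^ 2) = -(1 + k ^ 2) * thetaSn τ u ^ 2 +
        k ^ 2 * thetaSn τ u ^ 2 * thetaSn τ u ^ 2 by rw [h2]; ring]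
    linear_combination thetaDn τ u ^ 2 * hc + (1 - thetaSn τ u ^ 2) * hd
  have cm := am.continuousAt
  have cm' := am.deriv.continuousAt
  have cs := as.continuousAt
  have cc := ac.continuousAt
  have cd := ad.continuousAt
  have cl : ContinuousAt (fun u => (3 * m u + u * deriv m u) *
    (thetaCn τ u * thetaDn τ u + 1)) 0 := by fun_prop
  have cr : ContinuousAt (fun u => -(1 + k ^ 2) * (1 + u ^ 2 * m u) ^ 2 +
    k ^ 2 * thetaSn τ u ^ 2 * (1 + u ^ 2 * m u) ^ 2) 0 := by fun_prop
  have := tendsto_nhds_unique ((cl.tendsto.mono_left nhdsWithin_le_nhds).congr' key)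
    (cr.tendsto.mono_left nhdsWithin_le_nhds)
  rw [c0, d0, s0] at this
  linear_combination this

lemma tendsto_one_div_thetaSn_sq {τ : ℂ} (hτ : 0 < τ.im) :
    Tendsto (fun u => 1 / thetaSn τ u ^ 2 - 1 / u ^ 2) (𝓝[≠] 0)
      (𝓝 ((1 + thetaModulus τ ^ 2) / 3)) := by
  obtain ⟨m, am, hm0, hm⟩ := exists_thetaSn_eq hτ
  have cm := am.continuousAt
  have hne : ∀ᶠ u in 𝓝 (0 : ℂ), 1 + u ^ 2 * m u ≠ 0 :=
    ContinuousAt.eventually_ne (by fun_prop) (by norm_num)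
  have ct : ContinuousAt (fun u => -(2 * m u + u ^ 2 * m u ^ 2) / (1 + u ^ 2 * m u) ^ 2) 0 :=
    ContinuousAt.div (by fun_prop) (by fun_prop) (by norm_num)
  have h := ct.tendsto.mono_left (nhdsWithin_le_nhds (s := {0}ᶜ))
  rw [show -(2 * m 0 + 0 ^ 2 * m 0 ^ 2) / (1 + 0 ^ 2 * m 0) ^ 2 = (1 + thetaModulus τ ^ 2) / 3 by
    norm_num; linear_combination (-1 / 3) * hm0] at h
  refine h.congr' ?_
  filter_upwards [hm.filter_mono nhdsWithin_le_nhds, hne.filter_mono nhdsWithin_le_nhds,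
    self_mem_nhdsWithin] with u h1 h2 h3
  have h3' : u ≠ 0 := h3
  rw [h1, show u + u ^ 3 * m u = u * (1 + u ^ 2 * m u) by ring,
    div_sub_div _ _ (pow_ne_zero 2 (mul_ne_zero h3' h2)) (pow_ne_zero 2 h3'),
    div_eq_div_iff (pow_ne_zero 2 h2)
      (mul_ne_zero (pow_ne_zero 2 (mul_ne_zero h3' h2)) (pow_ne_zero 2 h3'))]
  ring

lemma mem_lattice_iff {τ : ℂ} (hτ : 0 < τ.im) {L : PeriodPair} (h1 : L.ω₁ = thetaPeriod τ)
    (h2 : L.ω₂ = thetaPeriod τ * τ) (u : ℂ) :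
    u ∈ L.lattice ↔ varTheta τ (u / thetaPeriod τ) = 0 := by
  have := thetaPeriod_ne_zero hτ
  rw [varTheta_eq_zero_iff hτ, PeriodPair.mem_lattice, h1, h2]
  refine exists_congr fun m => exists_congr fun n => ?_
  rw [div_eq_iff this]
  constructor <;> intro h <;> linear_combination -h

lemma one_div_thetaSn_sq (τ u : ℂ) :
    1 / thetaSn τ u ^ 2 = (theta01 τ (u / thetaPeriod τ) / (-I * theta00 τ 0 / theta10 τ 0 *
      varTheta τ (u / thetaPeriod τ))) ^ 2 := by
  rw [thetaSn, one_div, ← inv_pow, inv_div]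

lemma thetaSn_add_period {τ : ℂ} (hτ : 0 < τ.im) (u : ℂ) :
    1 / thetaSn τ (u + thetaPeriod τ) ^ 2 = 1 / thetaSn τ u ^ 2 := by
  rw [one_div_thetaSn_sq, one_div_thetaSn_sq, add_div, div_self (thetaPeriod_ne_zero hτ),
    theta01_add_one, varTheta_add_one, mul_neg, div_neg, neg_sq]

lemma thetaSn_add_period_mul {τ : ℂ} (hτ : 0 < τ.im) (u : ℂ) :
    1 / thetaSn τ (u + thetaPeriod τ * τ) ^ 2 = 1 / thetaSn τ u ^ 2 := by
  rw [one_div_thetaSn_sq, one_div_thetaSn_sq, add_div,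
    mul_div_cancel_left₀ _ (thetaPeriod_ne_zero hτ), theta01_add_tau, varTheta_add_tau,
    mul_left_comm, mul_div_mul_left _ _ (neg_ne_zero.mpr (Complex.exp_ne_zero _))]

open Classical in
/-- `1 / sn²` is the Weierstrass function up to a constant. -/
theorem one_div_thetaSn_sq_eq {τ : ℂ} (hτ : 0 < τ.im) {L : PeriodPair}
    (h1 : L.ω₁ = thetaPeriod τ) (h2 : L.ω₂ = thetaPeriod τ * τ) {u : ℂ} (hu : u ∉ L.lattice) :
    1 / thetaSn τ u ^ 2 = L.weierstrassP u + (1 + thetaModulus τ ^ 2) / 3 := by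
  have hω := thetaPeriod_ne_zero hτ
  set κ : ℂ := (1 + thetaModulus τ ^ 2) / 3 with hκ
  -- The value on the lattice is the limit of 1/sn² - ℘ at 0, so that F is continuous there. Here κ
  -- denotes this constant, not the root of 1 - k².
  let F : ℂ → ℂ := fun u => if u ∈ L.lattice then κ else 1 / thetaSn τ u ^ 2 - L.weierstrassP u
  have hF0 : F 0 = κ := if_pos L.lattice.zero_mem
  have P1 : ∀ u, F (u + L.ω₁) = F u := fun u => by
    simp only [F, L.lattice.add_mem_iff_left L.ω₁_mem_lattice]
    rw [L.weierstrassP_add_coe u ⟨_, L.ω₁_mem_lattice⟩, h1, thetaSn_add_period hτ]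
  have P2 : ∀ u, F (u + L.ω₂) = F u := fun u => by
    simp only [F, L.lattice.add_mem_iff_left L.ω₂_mem_lattice]
    rw [L.weierstrassP_add_coe u ⟨_, L.ω₂_mem_lattice⟩, h2, thetaSn_add_period_mul hτ]
  have hopen : IsOpen ((L.lattice : Set ℂ)ᶜ) := L.isClosed_lattice.isOpen_compl
  have hoff : ∀ u ∉ L.lattice, DifferentiableAt ℂ F u := fun u hu => by
    have D1 := differentiable_theta01 hτ
    have D3 := differentiable_varTheta hτ
    have hs : DifferentiableAt ℂ (fun u => 1 / thetaSn τ u ^ 2) u := by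
      simp only [one_div_thetaSn_sq]
      refine DifferentiableAt.fun_pow (DifferentiableAt.fun_div (by fun_prop) (by fun_prop) ?_) 2
      exact mul_ne_zero (thetaSn_coeff_ne_zero hτ) (mt (mem_lattice_iff hτ h1 h2 u).mpr hu)
    have hp := (L.differentiableOn_weierstrassP u hu).differentiableAt (hopen.mem_nhds hu)
    refine (hs.sub hp).congr_of_eventuallyEq ?_
    filter_upwards [hopen.mem_nhds hu] with v hv
    exact if_neg hv
  -- Both double poles are 1/u², so the singularity is removable; periodicity carries this to all
  -- lattice points.
  have hzero : DifferentiableAt ℂ F 0 := by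
    have hev : ∀ᶠ v in 𝓝[≠] (0 : ℂ), v ∉ L.lattice := by
      filter_upwards [(L.compl_lattice_sdiff_singleton_mem_nhds 0 : _ ∈ 𝓝 (0 : ℂ)) |>
        mem_nhdsWithin_of_mem_nhds, self_mem_nhdsWithin] with v hv hv0 hvL
      exact hv ⟨hvL, hv0⟩
    refine (analyticAt_of_differentiable_on_punctured_nhds_of_continuousAt
      (hev.mono fun v hv => hoff v hv) ?_).differentiableAt
    rw [continuousAt_iff_punctured_nhds, hF0]
    have hP : DifferentiableAt ℂ (L.weierstrassPExcept 0) 0 :=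
      (L.differentiableOn_weierstrassPExcept 0 0 (by simp)).differentiableAt
        (L.compl_lattice_sdiff_singleton_mem_nhds 0)
    have hP0 : L.weierstrassPExcept 0 0 = 0 := by
      simp [PeriodPair.weierstrassPExcept]
    have ht := (tendsto_one_div_thetaSn_sq hτ).sub
      (hP.continuousAt.tendsto.mono_left (nhdsWithin_le_nhds (s := {0}ᶜ)))
    rw [hP0, sub_zero] at ht
    refine ht.congr' ?_
    filter_upwards [hev] with v hv
    have e := L.weierstrassPExcept_add ⟨0, L.lattice.zero_mem⟩ v
    simp only [sub_zero] at e
    simp only [F, if_neg hv]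
    rw [← e]
    ring
  have hF : Differentiable ℂ F := fun u => by
    by_cases hu : u ∈ L.lattice
    · have hper : ∀ v, F (v - u) = F v := fun v => by
        obtain ⟨m, n, rfl⟩ := PeriodPair.mem_lattice.mp hu
        have q1 : Function.Periodic F L.ω₁ := P1
        have q2 : Function.Periodic F L.ω₂ := P2
        rw [← sub_sub, q2.sub_int_mul_eq n, q1.sub_int_mul_eq m]
      have : DifferentiableAt ℂ (fun v => F (v - u)) u := by
        rw [← sub_self u] at hzero
        exact hzero.comp u (f := fun v => v - u) (by fun_prop)
      simpa only [hper] using this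
    · exact hoff u hu
  have hconst := apply_eq_apply_of_periodic (F := fun z => F (thetaPeriod τ * z)) hτ
    (hF.comp (by fun_prop)) (fun z => by rw [mul_add, mul_one, ← h1, P1])
    (fun z => by rw [mul_add, ← h2, P2]) (u / thetaPeriod τ) 0
  simp only [mul_zero, mul_div_cancel₀ _ hω, hF0] at hconst
  simp only [F, if_neg hu] at hconst
  linear_combination hconst

/-! ### The bosonisation formulas -/

/-- Division by zero gives 0 at the poles, so the single condition sn ≠ 0 excludes poles as well as
zeros. -/
lemma thetaSn_ne_zero {τ u : ℂ} (h : thetaSn τ u ≠ 0) :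
    theta01 τ (u / thetaPeriod τ) ≠ 0 ∧ varTheta τ (u / thetaPeriod τ) ≠ 0 := by
  constructor <;> intro h0 <;> exact h (by simp [thetaSn, h0])

/-- `1 / sn (2q)`. -/
def nsTwo (k q : ℂ) : ℂ := (sn k (2 * q))⁻¹

/-- `cn (2q) / sn (2q)`. -/
def csTwo (k q : ℂ) : ℂ := cn k (2 * q) / sn k (2 * q)

/-- `dn (2q) / sn (2q)`. -/
def dsTwo (k q : ℂ) : ℂ := dn k (2 * q) / sn k (2 * q)

/-- The first-order system satisfied by `1 / sn (2q)`, `cn (2q) / sn (2q)`, `dn (2q) / sn (2q)`. -/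
structure RatioSystemAt (k q : ℂ) : Prop where
  ns : HasDerivAt (nsTwo k) (-2 * csTwo k q * dsTwo k q) q
  cs : HasDerivAt (csTwo k) (-2 * dsTwo k q * nsTwo k q) q
  ds : HasDerivAt (dsTwo k) (-2 * csTwo k q * nsTwo k q) q
  cs_sq : csTwo k q ^ 2 = nsTwo k q ^ 2 - 1
  ds_sq : dsTwo k q ^ 2 = nsTwo k q ^ 2 - k ^ 2

lemma ratioSystemAt {τ q : ℂ} (hτ : 0 < τ.im) (hq : sn (thetaModulus τ) (2 * q) ≠ 0) :
    RatioSystemAt (thetaModulus τ) q := by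
  obtain ⟨es, ec, ed⟩ := jacobi_eq_theta hτ
  rw [es] at hq
  obtain ⟨h1, -⟩ := thetaSn_ne_zero hq
  have hid : HasDerivAt (fun q : ℂ => 2 * q) (2 * 1) q := (hasDerivAt_id q).const_mul 2
  have hs := (hasDerivAt_thetaSn hτ h1).comp q hid
  have hc := (hasDerivAt_thetaCn hτ h1).comp q hid
  have hd := (hasDerivAt_thetaDn hτ h1).comp q hid
  have c2 := thetaCn_sq hτ h1
  have d2 := thetaDn_sq hτ h1
  have en : nsTwo (thetaModulus τ) = fun q => (thetaSn τ (2 * q))⁻¹ := by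
    funext q
    rw [nsTwo, es]
  have ecs : csTwo (thetaModulus τ) = fun q => thetaCn τ (2 * q) / thetaSn τ (2 * q) := by
    funext q
    rw [csTwo, es, ec]
  have eds : dsTwo (thetaModulus τ) = fun q => thetaDn τ (2 * q) / thetaSn τ (2 * q) := by
    funext q
    rw [dsTwo, es, ed]
  refine ⟨?_, ?_, ?_, ?_, ?_⟩
  · rw [en, ecs, eds]
    refine (hs.fun_inv hq).congr_deriv ?_
    simp only [Function.comp_apply]
    field_simp
  · rw [en, ecs, eds]
    refine (hc.fun_div hs hq).congr_deriv ?_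
    simp only [Function.comp_apply]
    field_simp
    linear_combination (-thetaDn τ (2 * q)) * c2
  · rw [en, ecs, eds]
    refine (hd.fun_div hs hq).congr_deriv ?_
    simp only [Function.comp_apply]
    field_simp
    linear_combination (-thetaCn τ (2 * q)) * d2
  · rw [en, ecs]
    field_simp
    linear_combination c2
  · rw [en, eds]
    field_simp
    linear_combination d2

section Formulas

variable {k κ : ℂ} (ν : ℂ)

lemma fh_eq : fh k = fun q => k⁻¹ * nsTwo k q := by
  funext q
  simp only [fh, nsTwo]
  ring

lemma gh_eq : gh k ν = fun q => -ν * k⁻¹ * (csTwo k q * dsTwo k q) := by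
  funext q
  simp only [gh, csTwo, dsTwo]
  ring

lemma ff_eq (hk : k ≠ 0) :
    ff k κ = fun q => -(1 / 2) * κ⁻¹ * (csTwo k q + k⁻¹ * dsTwo k q) := by
  funext q
  simp only [ff, csTwo, dsTwo]
  field_simp

lemma fe_eq (hk : k ≠ 0) :
    fe k κ = fun q => -(1 / 2) * κ⁻¹ * (csTwo k q - k⁻¹ * dsTwo k q) := by
  funext q
  simp only [fe, csTwo, dsTwo]
  field_simp

lemma gf_eq (hk : k ≠ 0) :
    gf k κ ν = fun q => 1 / 2 * ν * κ⁻¹ * ((dsTwo k q + k⁻¹ * csTwo k q) * nsTwo k q) := by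
  funext q
  simp only [gf, csTwo, dsTwo, nsTwo]
  field_simp

lemma ge_eq (hk : k ≠ 0) :
    ge k κ ν = fun q => 1 / 2 * ν * κ⁻¹ * ((dsTwo k q - k⁻¹ * csTwo k q) * nsTwo k q) := by
  funext q
  simp only [ge, csTwo, dsTwo, nsTwo]
  field_simp

lemma S1_eq (hk : k ≠ 0) (p q : ℂ) :
    S1 k κ ν p q = κ⁻¹ * (-csTwo k q * p + ν * (dsTwo k q * nsTwo k q)) := by
  simp only [S1, bosE, bosF, fe_eq hk, ff_eq hk, ge_eq ν hk, gf_eq ν hk]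
  ring

lemma S2_eq (hk : k ≠ 0) (p q : ℂ) :
    S2 k κ ν p q = -I * k⁻¹ * κ⁻¹ * (dsTwo k q * p - ν * (csTwo k q * nsTwo k q)) := by
  simp only [S2, bosE, bosF, fe_eq hk, ff_eq hk, ge_eq ν hk, gf_eq ν hk]
  ring

lemma S3_eq (p q : ℂ) :
    S3 k ν p q = k⁻¹ * (nsTwo k q * p - ν * (csTwo k q * dsTwo k q)) := by
  simp only [S3, bosH, fh_eq, gh_eq]
  ring

lemma bosonisationSystemAt (hk : k ≠ 0) (hκ : κ ≠ 0) (h : κ ^ 2 = 1 - k ^ 2) {q : ℂ}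
    (hq : RatioSystemAt k q) :
    BosonisationSystemAt (fh k) (gh k ν) (fe k κ) (ge k κ ν) (ff k κ) (gf k κ ν) q := by
  have d_fh := hq.ns.const_mul k⁻¹
  have d_gh := (hq.cs.fun_mul hq.ds).const_mul (-ν * k⁻¹)
  have d_ff := (hq.cs.fun_add (hq.ds.const_mul k⁻¹)).const_mul (-(1 / 2) * κ⁻¹)
  have d_fe := (hq.cs.fun_sub (hq.ds.const_mul k⁻¹)).const_mul (-(1 / 2) * κ⁻¹)
  have d_gf := ((hq.ds.fun_add (hq.cs.const_mul k⁻¹)).fun_mul hq.ns).const_mul (1 / 2 * ν * κ⁻¹)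
  have d_ge := ((hq.ds.fun_sub (hq.cs.const_mul k⁻¹)).fun_mul hq.ns).const_mul (1 / 2 * ν * κ⁻¹)
  have hc := hq.cs_sq
  have hd := hq.ds_sq
  have hkk : k * k⁻¹ = 1 := mul_inv_cancel₀ hk
  have hκκ : κ * κ⁻¹ = 1 := mul_inv_cancel₀ hκ
  rw [fh_eq, gh_eq, ff_eq hk, fe_eq hk, gf_eq ν hk, ge_eq ν hk]
  refine ⟨d_fh.differentiableAt, d_gh.differentiableAt, d_fe.differentiableAt,
    d_ge.differentiableAt, d_ff.differentiableAt, d_gf.differentiableAt, ?_, ?_, ?_, ?_, ?_, ?_⟩ <;>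
  simp only [d_fh.deriv, d_gh.deriv, d_ff.deriv, d_fe.deriv, d_gf.deriv, d_ge.deriv] <;>
  -- The rest is algebra in these letters, subject to the two quadrics, the relation between k and
  -- κ, and the two inverse relations.
  generalize nsTwo k q = i at * <;> generalize csTwo k q = x at * <;>
  generalize dsTwo k q = y at * <;> generalize k⁻¹ = K at * <;> generalize κ⁻¹ = M at * <;>
  grind

lemma boundary_casimir (hk : k ≠ 0) (hκ : κ ≠ 0) (h : κ ^ 2 = 1 - k ^ 2) {q : ℂ}
    (hq : RatioSystemAt k q) :
    k ^ 2 * (fe k κ q - ff k κ q) ^ 2 - (fe k κ q + ff k κ q) ^ 2 = 1 ∧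
    k ^ 2 * (fe k κ q - ff k κ q) * (ge k κ ν q - gf k κ ν q)
        - (fe k κ q + ff k κ q) * (ge k κ ν q + gf k κ ν q) = 0 ∧
    ∀ p : ℂ, bosH k ν p q ^ 2 + 4 * bosE k κ ν p q * bosF k κ ν p q = ν ^ 2 := by
  have hc := hq.cs_sq
  have hd := hq.ds_sq
  have hkk : k * k⁻¹ = 1 := mul_inv_cancel₀ hk
  have hκκ : κ * κ⁻¹ = 1 := mul_inv_cancel₀ hκ
  simp only [bosH, bosE, bosF, fh_eq, gh_eq, ff_eq hk, fe_eq hk, gf_eq ν hk, ge_eq ν hk]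
  generalize nsTwo k q = i at *
  generalize csTwo k q = x at *
  generalize dsTwo k q = y at *
  generalize k⁻¹ = K at *
  generalize κ⁻¹ = M at *
  refine ⟨by grind, by grind, fun p => by grind⟩

lemma poisson_eq {F G : ℂ → ℂ → ℂ} {a b c d : ℂ → ℂ} {a' b' c' d' q : ℂ} (p : ℂ)
    (hF : ∀ p q, F p q = a q * p + b q) (hG : ∀ p q, G p q = c q * p + d q)
    (ha : HasDerivAt a a' q) (hb : HasDerivAt b b' q) (hc : HasDerivAt c c' q)
    (hd : HasDerivAt d d' q) :
    poisson F G p q = a q * (c' * p + d') - (a' * p + b') * c q := by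
  have e1 : HasDerivAt (fun x => F x q) (a q * 1) p := by
    simp only [hF]
    exact ((hasDerivAt_id p).const_mul (a q)).add_const (b q)
  have e2 : HasDerivAt (fun x => G x q) (c q * 1) p := by
    simp only [hG]
    exact ((hasDerivAt_id p).const_mul (c q)).add_const (d q)
  have e3 : HasDerivAt (fun y => F p y) (a' * p + b') q := by
    simp only [hF]
    exact (ha.mul_const p).fun_add hb
  have e4 : HasDerivAt (fun y => G p y) (c' * p + d') q := by
    simp only [hG]
    exact (hc.mul_const p).fun_add hd
  rw [poisson, e1.deriv, e2.deriv, e3.deriv, e4.deriv]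
  ring

lemma poisson_S (hk : k ≠ 0) (hκ : κ ≠ 0) (h : κ ^ 2 = 1 - k ^ 2) {q : ℂ}
    (hq : RatioSystemAt k q) (p : ℂ) :
    poisson (S1 k κ ν) (S2 k κ ν) p q = 2 * I * S3 k ν p q ∧
    poisson (S2 k κ ν) (S3 k ν) p q = 2 * I * S1 k κ ν p q ∧
    poisson (S3 k ν) (S1 k κ ν) p q = 2 * I * S2 k κ ν p q := by
  have hc := hq.cs_sq
  have hd := hq.ds_sq
  have hkk : k * k⁻¹ = 1 := mul_inv_cancel₀ hk
  have hκκ : κ * κ⁻¹ = 1 := mul_inv_cancel₀ hκ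
  have f1 : ∀ p q, S1 k κ ν p q =
      (-κ⁻¹ * csTwo k q) * p + κ⁻¹ * ν * (dsTwo k q * nsTwo k q) := fun p q => by
    rw [S1_eq ν hk]
    ring
  have f2 : ∀ p q, S2 k κ ν p q = (-I * k⁻¹ * κ⁻¹ * dsTwo k q) * p +
      I * k⁻¹ * κ⁻¹ * ν * (csTwo k q * nsTwo k q) := fun p q => by
    rw [S2_eq ν hk]
    ring
  have f3 : ∀ p q, S3 k ν p q =
      (k⁻¹ * nsTwo k q) * p + -k⁻¹ * ν * (csTwo k q * dsTwo k q) := fun p q => by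
    rw [S3_eq ν]
    ring
  have a1 := hq.cs.const_mul (-κ⁻¹)
  have b1 := (hq.ds.fun_mul hq.ns).const_mul (κ⁻¹ * ν)
  have a2 := hq.ds.const_mul (-I * k⁻¹ * κ⁻¹)
  have b2 := (hq.cs.fun_mul hq.ns).const_mul (I * k⁻¹ * κ⁻¹ * ν)
  have a3 := hq.ns.const_mul k⁻¹
  have b3 := (hq.cs.fun_mul hq.ds).const_mul (-k⁻¹ * ν)
  rw [poisson_eq p f1 f2 a1 b1 a2 b2, poisson_eq p f2 f3 a2 b2 a3 b3,
    poisson_eq p f3 f1 a3 b3 a1 b1, f1, f2, f3]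
  have hI := I_sq
  generalize nsTwo k q = i at *
  generalize csTwo k q = x at *
  generalize dsTwo k q = y at *
  generalize k⁻¹ = K at *
  generalize κ⁻¹ = M at *
  generalize I = J at *
  refine ⟨by grind, by grind, by grind⟩

lemma topHamiltonian_eq (hk : k ≠ 0) (hκ : κ ≠ 0) (h : κ ^ 2 = 1 - k ^ 2) {q : ℂ}
    (hq : RatioSystemAt k q) (p : ℂ) :
    topHamiltonian k (bosE k κ ν p q) (bosF k κ ν p q) =
      p ^ 2 - ν ^ 2 * (1 / sn k (2 * q) ^ 2) := by
  have hc := hq.cs_sq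
  have hd := hq.ds_sq
  have hkk : k * k⁻¹ = 1 := mul_inv_cancel₀ hk
  have hκκ : κ * κ⁻¹ = 1 := mul_inv_cancel₀ hκ
  rw [one_div, ← inv_pow, ← nsTwo]
  simp only [topHamiltonian, bosE, bosF, ff_eq hk, fe_eq hk, gf_eq ν hk, ge_eq ν hk]
  generalize nsTwo k q = i at *
  generalize csTwo k q = x at *
  generalize dsTwo k q = y at *
  generalize k⁻¹ = K at *
  generalize κ⁻¹ = M at *
  grind

end Formulas

/-! ### The theta function formulas -/

section ThetaFormulas

variable {τ : ℂ} (ν : ℂ)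

lemma S_theta (hτ : 0 < τ.im) (p q : ℂ)
    (hq : sn (thetaModulus τ) (2 * (thetaPeriod τ * q)) ≠ 0) :
    S1 (thetaModulus τ) (-thetaComodulus τ) ν (p / thetaPeriod τ) (thetaPeriod τ * q)
      = -(theta10 τ 0 * theta10 τ (2 * q) / (varThetaDerivZero τ * varTheta τ (2 * q))) * p
        + theta10 τ 0 ^ 2 * theta00 τ (2 * q) * theta01 τ (2 * q)
          / (theta00 τ 0 * theta01 τ 0 * varTheta τ (2 * q) ^ 2) * ν ∧
    S2 (thetaModulus τ) (-thetaComodulus τ) ν (p / thetaPeriod τ) (thetaPeriod τ * q)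
      = theta00 τ 0 * theta00 τ (2 * q) / (I * varThetaDerivZero τ * varTheta τ (2 * q)) * p
        - theta00 τ 0 ^ 2 * theta10 τ (2 * q) * theta01 τ (2 * q)
          / (I * theta10 τ 0 * theta01 τ 0 * varTheta τ (2 * q) ^ 2) * ν ∧
    S3 (thetaModulus τ) ν (p / thetaPeriod τ) (thetaPeriod τ * q)
      = -(theta01 τ 0 * theta01 τ (2 * q) / (varThetaDerivZero τ * varTheta τ (2 * q))) * p
        + theta01 τ 0 ^ 2 * theta00 τ (2 * q) * theta10 τ (2 * q)
          / (theta00 τ 0 * theta10 τ 0 * varTheta τ (2 * q) ^ 2) * ν := by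
  obtain ⟨es, ec, ed⟩ := jacobi_eq_theta hτ
  rw [es] at hq
  obtain ⟨h1, h3⟩ := thetaSn_ne_zero hq
  have hω := thetaPeriod_ne_zero hτ
  have harg : 2 * (thetaPeriod τ * q) / thetaPeriod τ = 2 * q := by
    field_simp
  rw [harg] at h1 h3
  have n0 := theta00_zero_ne_zero hτ
  have n1 := theta01_zero_ne_zero hτ
  have n2 := theta10_zero_ne_zero hτ
  have hpi : (Real.pi : ℂ) ≠ 0 := by exact_mod_cast Real.pi_ne_zero
  have hI := I_ne_zero
  rw [S1_eq ν (thetaModulus_ne_zero hτ), S2_eq ν (thetaModulus_ne_zero hτ), S3_eq]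
  -- Jacobi's formula removes ϑ'(0), so that both sides are rational in theta values, π and a square
  -- root of -1.
  simp only [nsTwo, csTwo, dsTwo, es, ec, ed, thetaSn, thetaCn, thetaDn, harg,
    varThetaDerivZero_eq_mul hτ]
  rw [thetaPeriod, thetaModulus, thetaComodulus]
  have hI2 := I_sq
  generalize I = J at *
  refine ⟨?_, ?_, ?_⟩
  · field_simp
    grind
  · field_simp
    grind
  · field_simp
    grind

end ThetaFormulas

/-! ### The period lattice and the exceptional set -/

lemma exists_periodPair {τ : ℂ} (hτ : 0 < τ.im) :
    ∃ L : PeriodPair, L.ω₁ = thetaPeriod τ ∧ L.ω₂ = thetaPeriod τ * τ := by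
  refine ⟨⟨thetaPeriod τ, thetaPeriod τ * τ, LinearIndependent.pair_iff.mpr fun a b h => ?_⟩,
    rfl, rfl⟩
  have h' : thetaPeriod τ * (a + b * τ) = 0 := by
    simp only [Complex.real_smul] at h
    linear_combination h
  have h2 := (mul_eq_zero.mp h').resolve_left (thetaPeriod_ne_zero hτ)
  have him := congrArg Complex.im h2
  simp only [Complex.add_im, Complex.ofReal_im, Complex.im_ofReal_mul, zero_add,
    Complex.zero_im] at him
  have hb := (mul_eq_zero.mp him).resolve_right hτ.ne'
  subst hb
  have hre := congrArg Complex.re h2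
  simpa using hre

lemma sn_ne_zero_mem_codiscrete {τ : ℂ} (hτ : 0 < τ.im) :
    {q : ℂ | sn (thetaModulus τ) (2 * q) ≠ 0} ∈ codiscrete ℂ := by
  obtain ⟨w, hw⟩ := exists_varTheta_ne_zero hτ
  have hω : thetaPeriod τ / 2 ≠ 0 := div_ne_zero (thetaPeriod_ne_zero hτ) two_ne_zero
  filter_upwards [codiscrete_comp_div_ne_zero (differentiable_varTheta hτ) hw hω,
    codiscrete_comp_div_ne_zero (differentiable_theta01 hτ) (theta01_zero_ne_zero hτ) hω]
    with q h1 h2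
  have e : q / (thetaPeriod τ / 2) = 2 * q / thetaPeriod τ := by
    field_simp
  simp only [e] at h1 h2 ⊢
  rw [(jacobi_eq_theta hτ).1]
  exact div_ne_zero (mul_ne_zero (thetaSn_coeff_ne_zero hτ) h1) h2

end XYZTop

end

theorem mainTheorem3 (k κ ν : ℂ) (hk : k ≠ 0) (hκ : κ ≠ 0) (hκk : κ ^ 2 = 1 - k ^ 2) :
    -- the Jacobi functions exist and are unique, and the formulas make sense off a discrete set
    (∃! t : (ℂ → ℂ) × (ℂ → ℂ) × (ℂ → ℂ), XYZTop.IsJacobiTriple k t.1 t.2.1 t.2.2) ∧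
    XYZTop.IsJacobiTriple k (XYZTop.sn k) (XYZTop.cn k) (XYZTop.dn k) ∧
    {q : ℂ | XYZTop.sn k (2 * q) ≠ 0} ∈ Filter.codiscrete ℂ ∧
    -- the differential system, the boundary conditions and the Casimir condition
    (∀ q : ℂ, XYZTop.sn k (2 * q) ≠ 0 →
      XYZTop.BosonisationSystemAt (XYZTop.fh k) (XYZTop.gh k ν) (XYZTop.fe k κ)
        (XYZTop.ge k κ ν) (XYZTop.ff k κ) (XYZTop.gf k κ ν) q ∧
      k ^ 2 * (XYZTop.fe k κ q - XYZTop.ff k κ q) ^ 2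
        - (XYZTop.fe k κ q + XYZTop.ff k κ q) ^ 2 = 1 ∧
      k ^ 2 * (XYZTop.fe k κ q - XYZTop.ff k κ q) * (XYZTop.ge k κ ν q - XYZTop.gf k κ ν q)
        - (XYZTop.fe k κ q + XYZTop.ff k κ q) * (XYZTop.ge k κ ν q + XYZTop.gf k κ ν q) = 0 ∧
      ∀ p : ℂ, XYZTop.bosH k ν p q ^ 2
        + 4 * XYZTop.bosE k κ ν p q * XYZTop.bosF k κ ν p q = ν ^ 2) ∧
    -- the standard basis, its brackets, and the Hamiltonian
    (∀ p q : ℂ, XYZTop.sn k (2 * q) ≠ 0 →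
      XYZTop.S1 k κ ν p q = 1 / κ *
        (-(XYZTop.cn k (2 * q) / XYZTop.sn k (2 * q)) * p
          + ν * XYZTop.dn k (2 * q) / XYZTop.sn k (2 * q) ^ 2) ∧
      XYZTop.S2 k κ ν p q = 1 / (Complex.I * k * κ) *
        (XYZTop.dn k (2 * q) / XYZTop.sn k (2 * q) * p
          - ν * XYZTop.cn k (2 * q) / XYZTop.sn k (2 * q) ^ 2) ∧
      XYZTop.S3 k ν p q = 1 / k *
        (p / XYZTop.sn k (2 * q)
          - ν * XYZTop.dn k (2 * q) * XYZTop.cn k (2 * q) / XYZTop.sn k (2 * q) ^ 2) ∧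
      XYZTop.poisson (XYZTop.S1 k κ ν) (XYZTop.S2 k κ ν) p q
        = 2 * Complex.I * XYZTop.S3 k ν p q ∧
      XYZTop.poisson (XYZTop.S2 k κ ν) (XYZTop.S3 k ν) p q
        = 2 * Complex.I * XYZTop.S1 k κ ν p q ∧
      XYZTop.poisson (XYZTop.S3 k ν) (XYZTop.S1 k κ ν) p q
        = 2 * Complex.I * XYZTop.S2 k κ ν p q ∧
      XYZTop.topHamiltonian k (XYZTop.bosE k κ ν p q) (XYZTop.bosF k κ ν p q)
        = p ^ 2 - ν ^ 2 * (1 / XYZTop.sn k (2 * q) ^ 2)) ∧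
    -- a modular parameter belonging to the modulus `k` and the root `κ` exists
    (∃ τ : ℂ, 0 < τ.im ∧ k = XYZTop.theta10 τ 0 ^ 2 / XYZTop.theta00 τ 0 ^ 2 ∧
      κ = -(XYZTop.theta01 τ 0 ^ 2 / XYZTop.theta00 τ 0 ^ 2)) ∧
    -- for each such parameter: the theta function formulas and the Weierstrass potential
    (∀ τ : ℂ, 0 < τ.im → k = XYZTop.theta10 τ 0 ^ 2 / XYZTop.theta00 τ 0 ^ 2 →
      κ = -(XYZTop.theta01 τ 0 ^ 2 / XYZTop.theta00 τ 0 ^ 2) →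
      (∀ p q : ℂ, XYZTop.sn k (2 * (Real.pi * XYZTop.theta00 τ 0 ^ 2 * q)) ≠ 0 →
        XYZTop.S1 k κ ν (p / (Real.pi * XYZTop.theta00 τ 0 ^ 2))
            (Real.pi * XYZTop.theta00 τ 0 ^ 2 * q)
          = -(XYZTop.theta10 τ 0 * XYZTop.theta10 τ (2 * q)
              / (XYZTop.varThetaDerivZero τ * XYZTop.varTheta τ (2 * q))) * p
            + XYZTop.theta10 τ 0 ^ 2 * XYZTop.theta00 τ (2 * q) * XYZTop.theta01 τ (2 * q)
              / (XYZTop.theta00 τ 0 * XYZTop.theta01 τ 0 * XYZTop.varTheta τ (2 * q) ^ 2) * ν ∧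
        XYZTop.S2 k κ ν (p / (Real.pi * XYZTop.theta00 τ 0 ^ 2))
            (Real.pi * XYZTop.theta00 τ 0 ^ 2 * q)
          = XYZTop.theta00 τ 0 * XYZTop.theta00 τ (2 * q)
              / (Complex.I * XYZTop.varThetaDerivZero τ * XYZTop.varTheta τ (2 * q)) * p
            - XYZTop.theta00 τ 0 ^ 2 * XYZTop.theta10 τ (2 * q) * XYZTop.theta01 τ (2 * q)
              / (Complex.I * XYZTop.theta10 τ 0 * XYZTop.theta01 τ 0
                  * XYZTop.varTheta τ (2 * q) ^ 2) * ν ∧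
        XYZTop.S3 k ν (p / (Real.pi * XYZTop.theta00 τ 0 ^ 2))
            (Real.pi * XYZTop.theta00 τ 0 ^ 2 * q)
          = -(XYZTop.theta01 τ 0 * XYZTop.theta01 τ (2 * q)
              / (XYZTop.varThetaDerivZero τ * XYZTop.varTheta τ (2 * q))) * p
            + XYZTop.theta01 τ 0 ^ 2 * XYZTop.theta00 τ (2 * q) * XYZTop.theta10 τ (2 * q)
              / (XYZTop.theta00 τ 0 * XYZTop.theta10 τ 0 * XYZTop.varTheta τ (2 * q) ^ 2) * ν) ∧
      ∃ L : PeriodPair, L.ω₁ = Real.pi * XYZTop.theta00 τ 0 ^ 2 ∧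
        L.ω₂ = Real.pi * XYZTop.theta00 τ 0 ^ 2 * τ ∧
        ∀ p q : ℂ, XYZTop.sn k (2 * q) ≠ 0 →
          2 * q ∉ L.lattice ∧
          XYZTop.topHamiltonian k (XYZTop.bosE k κ ν p q) (XYZTop.bosF k κ ν p q)
            = p ^ 2 - ν ^ 2 * (L.weierstrassP (2 * q) + (1 + k ^ 2) / 3)) := by
  -- The uniformisation is applied to -κ, because the theta formulas use the root -θ₀₁²/θ₀₀².
  obtain ⟨τ, hτ, hkτ, hκτ⟩ := XYZTop.exists_thetaModulus_thetaComodulus hk (neg_ne_zero.mpr hκ)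
    (by rw [neg_sq, hκk])
  have hJ : XYZTop.IsJacobiTriple k (XYZTop.thetaSn τ) (XYZTop.thetaCn τ) (XYZTop.thetaDn τ) :=
    hkτ ▸ XYZTop.isJacobiTriple_theta hτ
  have hR : ∀ q, XYZTop.sn k (2 * q) ≠ 0 → XYZTop.RatioSystemAt k q := fun q hq => by
    subst hkτ
    exact XYZTop.ratioSystemAt hτ hq
  refine ⟨⟨(_, _, _), hJ, ?_⟩, XYZTop.isJacobiTriple_jacobiTriple hJ, ?_, ?_, ?_, ?_, ?_⟩
  · rintro ⟨s, c, d⟩ h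
    obtain ⟨rfl, rfl, rfl⟩ := XYZTop.IsJacobiTriple.unique h hJ
    rfl
  · rw [← hkτ]
    exact XYZTop.sn_ne_zero_mem_codiscrete hτ
  · exact fun q hq => ⟨XYZTop.bosonisationSystemAt ν hk hκ hκk (hR q hq),
      XYZTop.boundary_casimir ν hk hκ hκk (hR q hq)⟩
  · intro p q hq
    obtain ⟨h1, h2, h3⟩ := XYZTop.poisson_S ν hk hκ hκk (hR q hq) p
    refine ⟨?_, ?_, ?_, h1, h2, h3, XYZTop.topHamiltonian_eq ν hk hκ hκk (hR q hq) p⟩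
    · rw [XYZTop.S1_eq ν hk, XYZTop.csTwo, XYZTop.dsTwo, XYZTop.nsTwo]
      ring
    · rw [XYZTop.S2_eq ν hk, XYZTop.csTwo, XYZTop.dsTwo, XYZTop.nsTwo, one_div, mul_inv, mul_inv,
        Complex.inv_I]
      ring
    · rw [XYZTop.S3_eq ν, XYZTop.csTwo, XYZTop.dsTwo, XYZTop.nsTwo]
      ring
  · refine ⟨τ, hτ, hkτ.symm, ?_⟩
    change κ = -XYZTop.thetaComodulus τ
    rw [hκτ, neg_neg]
  -- The last part concerns every τ compatible with (k, κ), not only the one chosen above.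
  · clear! τ
    intro τ hτ hkτ hκτ
    have hkτ' : k = XYZTop.thetaModulus τ := hkτ
    have hκτ' : κ = -XYZTop.thetaComodulus τ := hκτ
    refine ⟨fun p q hq => ?_, ?_⟩
    · clear hkτ hκτ
      subst hkτ' hκτ'
      exact XYZTop.S_theta ν hτ p q hq
    · obtain ⟨L, h1, h2⟩ := XYZTop.exists_periodPair hτ
      refine ⟨L, h1, h2, fun p q hq => ?_⟩
      clear hkτ hκτ
      subst hkτ' hκτ'
      have hmem : 2 * q ∉ L.lattice := fun h => hq <| by
        rw [(XYZTop.jacobi_eq_theta hτ).1, XYZTop.thetaSn,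
          (XYZTop.mem_lattice_iff hτ h1 h2 _).mp h, mul_zero, zero_div]
      refine ⟨hmem, ?_⟩
      rw [XYZTop.topHamiltonian_eq ν hk hκ hκk (XYZTop.ratioSystemAt hτ hq),
        (XYZTop.jacobi_eq_theta hτ).1, XYZTop.one_div_thetaSn_sq_eq hτ h1 h2 hmem]
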